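/- **Theorem (cooperative guidance command for simultaneous interception).** *Setting.* Let $N\ge 2$ interceptors with constant speeds $V_i>0$ engage a stationary target at $p\in\mathbb R^2$. With range $r_i$, line-of-sight angle $\theta_i$ (from interceptor to target), flight path angle $\gamma_i$, lead angle $\sigma_i=\gamma_i-\theta_i$ and lateral acceleration $a_i$, $$\dot r_i=-V_i\cos\sigma_i,\qquad r_i\dot\theta_i=-V_i\sin\sigma_i,\qquad \dot\gamma_i=a_i/V_i ,$$ and the position of interceptor $i$ is $x_i=p-r_i(\cos\theta_i,\sin\theta_i)$. The time-to-go is estimated by $t_{\mathrm{go},i}=\frac{r_i}{V_i}\bigl(1+\frac{\sin^2\sigma_i}{k_i}\bigr)$ with $k_i=4N_i-2$, $N_i>2$, and the time-to-go errors are $e_i=t_{\mathrm{go},i}-t_{\mathrm{go},d}$ for a common, not preassigned, desired time-to-go $t_{\mathrm{go},d}$. For $c>0$ let $f(t,c)=\frac c\pi\sin\frac{\pi t}{c}+t-c$, $\dot f(t,c)=\cos\frac{\pi t}{c}+1$ for $0\le t<c$, and $f(t,c)=1$, $\dot f(t,c)=0$ for $t\ge c$. Fix $0<t_p<t_e$.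 The sensing graph is a directed graph on the target (node $0$) and the interceptors (nodes $1,\dots,N$); $a_{ij}=1$ if there is an edge from $j$ to $i\ne j$, and $a_{ij}=0$ otherwise. The target has no incoming edge and every node can be reached from it. Each interceptor runs the observer $$\dot{\hat p}_i=-\Bigl(\alpha-\beta\frac{\dot f(t,t_p)}{f(t,t_p)}\Bigr)\Bigl(a_{i0}(\hat p_i-p)+\sum_{j=1}^N a_{ij}(\hat p_i-\hat p_j)\Bigr),\qquad \alpha>0,\quad \beta\ge\frac{2\lambda_{\max}(M)}{\lambda_{\min}(C)},$$ where $\mathcal L_{II}$ is the block of the graph Laplacian (in-degree minus adjacency) belonging to the interceptors, $M=\operatorname{diag}\bigl((\mathcal L_{II}^\top)^{-1}\mathbf 1\bigr)$ and $C=M\mathcal L_{II}+\mathcal L_{II}^\top M$. Let $\hat r_i=\|\hat p_i-x_i\|$, let $\hat\theta_i$ be the polar (four-quadrant) angle of $\hat p_i-x_i$, $\hat\sigma_i=\gamma_i-\hat\theta_i$, and $\dot{\hat\theta}_i:=-V_i\sin\hat\sigma_i/\hat r_i$. The actuation graph is a strongly connected directed graph on the interceptors with Laplacian $\mathcal L_I$,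 and $\lambda_2$ is the second smallest eigenvalue, counted with multiplicity, of the Laplacian of its mirror graph (the undirected graph whose edge weights are the means of the weights of the two directions). Let $\zeta>0$, $\eta\ge 1/\lambda_2$, and let every interceptor apply $$a_i=V_i\dot{\hat\theta}_i+\frac{V_i^2k_i(\cos\hat\sigma_i-1)}{\hat r_i\sin2\hat\sigma_i}+\frac{V_i^2\sin\hat\sigma_i}{2\hat r_i}+\frac{V_i^2k_i}{\hat r_i\sin2\hat\sigma_i}\Bigl(-\zeta+\eta\frac{\dot f(t,t_e)}{f(t,t_e)}\Bigr)\sum_{j=1}^N[\mathcal L_I]_{ij}e_j$$ (the last sum does not depend on $t_{\mathrm{go},d}$). A *regular trajectory on $[0,T)$* is a continuous solution $(r_i,\theta_i,\gamma_i,\hat p_i)_{i}$ of this closed loop on $[0,T)$ (the differential equations hold on $(0,T)$ except possibly at $t_p$ and $t_e$) with $r_i>0$, $\hat r_i\ne0$ and $\sin2\hat\sigma_i\neq0$ for all $i$ on $[0,T)$, i.e. no interceptor has reached the target yet and the command is non-singular. *Claim.* For every $R$: 1. *(Boundedness before the observer converges.)* There is a constant $C$ such that for every $T$ and every regular trajectory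 on $[0,T)$ with $r_i(0)\le R$ for all $i$, one has $|e_i(t)-e_j(t)|\le C$ for all $i,j$ and all $t\in[0,T)$ with $t<t_p$. 2. There is a constant $C$ such that for every $T\ge t_e$ and every regular trajectory on $[0,T)$ with $r_i(0)\le R$ for all $i$, there is a time $T_f\ge T$, determined by the trajectory, such that the errors $e_i(t)=t_{\mathrm{go},i}(t)-(T_f-t)$ satisfy: * $|e_i(t)|\le C$ for all $i$ and $t\in[0,T)$, in particular before $t_p$; * *(consensus within the predefined time)* $e_i(t)\to0$ as $t\to t_e^-$, and $e_i(t)=0$ for all $t\in[t_e,T)$; * *(simultaneous interception)* if moreover $T>t_e$ and the initial estimated lead angles are acute, $\cos\hat\sigma_i(0)>0$ for all $i$, then the trajectory extends to a regular trajectory on $[0,T_f)$, with $e_i=0$ on $[t_e,T_f)$, $r_i(t)>0$ for $t<T_f$ and $r_i(t)\to0$ as $t\to T_f^-$, for every $i$: all interceptors reach the target at the same time $T_f$. -/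

import Mathlib

open Real Set Filter Topology

/-! ### Graphs, Laplacians and their eigenvalues -/

/-- Laplacian of a weight matrix `W` (`W i j` is the weight with which `i` listens to `j`). -/
noncomputable def weightLaplacian {n : Type*} [Fintype n] [DecidableEq n]
    (W : Matrix n n ℝ) : Matrix n n ℝ :=
  Matrix.diagonal (fun i => ∑ j, W i j) - W

open Classical in
/-- Adjacency matrix of a directed graph: entry `(i, j)` is `1` if there is an information link
from `j` to `i` (`j ≠ i`) and `0` otherwise; the diagonal vanishes. -/
noncomputable def digraphAdj {n : Type*} (G : Digraph n) : Matrix n n ℝ :=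
  Matrix.of fun i j => if i ≠ j ∧ G.Adj j i then 1 else 0

/-- Laplacian (in-degree matrix minus adjacency matrix) of a directed graph. -/
noncomputable def digraphLaplacian {n : Type*} [Fintype n] [DecidableEq n]
    (G : Digraph n) : Matrix n n ℝ :=
  weightLaplacian (digraphAdj G)

/-- Every node can be reached from every other one along directed edges. -/
def StronglyConnected {n : Type*} (G : Digraph n) : Prop :=
  ∀ i j, Relation.ReflTransGen G.Adj i j

/-- Laplacian of the mirror graph: the undirected graph with weights `(a i j + a j i) / 2`. -/
noncomputable def mirrorLaplacian {n : Type*} [Fintype n] [DecidableEq n]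
    (G : Digraph n) : Matrix n n ℝ :=
  weightLaplacian (Matrix.of fun i j => (digraphAdj G i j + digraphAdj G j i) / 2)

theorem mirrorLaplacian_isHermitian {n : Type*} [Fintype n] [DecidableEq n] (G : Digraph n) :
    (mirrorLaplacian G).IsHermitian := by
  unfold mirrorLaplacian weightLaplacian
  refine (Matrix.isHermitian_diagonal _).sub ?_
  ext i j
  simp [add_comm]

/-- Fiedler eigenvalue of the mirror graph: the second smallest eigenvalue, counted with
multiplicity, of its Laplacian. Mathlib's `eigenvalues₀` lists the eigenvalues in decreasing order,
so it is the one with index `N - 2`. -/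
noncomputable def mirrorLambda2 {N : ℕ} (hN : 2 ≤ N) (G : Digraph (Fin N)) : ℝ :=
  (mirrorLaplacian_isHermitian G).eigenvalues₀
    ⟨N - 2, by rw [Fintype.card_fin]; exact Nat.sub_lt (by linarith) (by norm_num)⟩

/-- Reduced Laplacian of the interceptors in a sensing graph whose node `0` is the target and whose
node `i.succ` is the interceptor `i`. -/
noncomputable def reducedLaplacian {N : ℕ} (S : Digraph (Fin (N + 1))) :
    Matrix (Fin N) (Fin N) ℝ :=
  (digraphLaplacian S).submatrix Fin.succ Fin.succ

/-- `M = diag(μ)` with `μ = (L_IIᵀ)⁻¹ 1`. -/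
noncomputable def observerM {N : ℕ} (S : Digraph (Fin (N + 1))) : Matrix (Fin N) (Fin N) ℝ :=
  Matrix.diagonal (((reducedLaplacian S).transpose)⁻¹.mulVec fun _ => 1)

/-- `C = M L_II + L_IIᵀ M`. -/
noncomputable def observerC {N : ℕ} (S : Digraph (Fin (N + 1))) : Matrix (Fin N) (Fin N) ℝ :=
  observerM S * reducedLaplacian S + (reducedLaplacian S).transpose * observerM S

/-- Largest eigenvalue of a real symmetric matrix. -/
noncomputable def eigMax {N : ℕ} (A : Matrix (Fin N) (Fin N) ℝ) : ℝ := sSup (spectrum ℝ A)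

/-- Smallest eigenvalue of a real symmetric matrix. -/
noncomputable def eigMin {N : ℕ} (A : Matrix (Fin N) (Fin N) ℝ) : ℝ := sInf (spectrum ℝ A)

/-! ### The time-varying scaling function -/

/-- `f(t, c) = (c/π) sin(π t / c) + t - c` for `t < c`, and `1` for `t ≥ c`. -/
noncomputable def scaling (t c : ℝ) : ℝ :=
  if t < c then c / π * sin (π / c * t) + t - c else 1

/-- The time derivative of the scaling function: `cos(π t / c) + 1` for `t < c`, and `0` for
`t ≥ c`. -/
noncomputable def scalingDot (t c : ℝ) : ℝ :=
  if t < c then cos (π / c * t) + 1 else 0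

/-! ### The engagement -/

/-- The data of an engagement of `N` interceptors with a stationary target in the plane, which is
identified with `ℂ`. -/
structure Engagement (N : ℕ) where
  /-- speeds -/
  V : Fin N → ℝ
  /-- navigation constants -/
  nav : Fin N → ℝ
  /-- position of the target -/
  target : ℂ
  /-- sensing graph: node `0` is the target, node `i.succ` the interceptor `i` -/
  S : Digraph (Fin (N + 1))
  /-- actuation graph -/
  A : Digraph (Fin N)
  /-- gains of the observer -/
  α : ℝ
  β : ℝ
  /-- gains of the consensus term -/
  ζ : ℝ
  η : ℝ
  /-- predefined convergence time of the observer -/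
  tp : ℝ
  /-- predefined time of the time-to-go consensus -/
  te : ℝ

/-- Time histories of the ranges, line-of-sight angles, flight path angles, and of the estimates of
the target's position made by the interceptors. -/
structure History (N : ℕ) where
  r : Fin N → ℝ → ℝ
  θ : Fin N → ℝ → ℝ
  γ : Fin N → ℝ → ℝ
  est : Fin N → ℝ → ℂ

namespace Engagement

variable {N : ℕ} (E : Engagement N) (X : History N)

/-- `k = 4 N_i - 2`. -/
noncomputable def k (i : Fin N) : ℝ := 4 * E.nav i - 2

/-- Lead angle. -/
noncomputable def leadAngle (i : Fin N) (t : ℝ) : ℝ := X.γ i t - X.θ i t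

/-- Improved time-to-go estimate `(r/V) (1 + sin² σ / k)`. -/
noncomputable def timeToGo (i : Fin N) (t : ℝ) : ℝ :=
  X.r i t / E.V i * (1 + sin (leadAngle X i t) ^ 2 / E.k i)

/-- Time-to-go error with respect to a desired time-to-go `tgod`. -/
noncomputable def err (tgod : ℝ → ℝ) (i : Fin N) (t : ℝ) : ℝ := E.timeToGo X i t - tgod t

/-- Position of an interceptor; the line of sight points from the interceptor to the target. -/
noncomputable def position (i : Fin N) (t : ℝ) : ℂ :=
  E.target - X.r i t * Complex.exp (X.θ i t * Complex.I)

/-- Estimated range. -/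
noncomputable def rHat (i : Fin N) (t : ℝ) : ℝ := ‖X.est i t - E.position X i t‖

/-- Estimated line-of-sight angle (four-quadrant inverse tangent). -/
noncomputable def θHat (i : Fin N) (t : ℝ) : ℝ := Complex.arg (X.est i t - E.position X i t)

/-- Estimated lead angle. -/
noncomputable def σHat (i : Fin N) (t : ℝ) : ℝ := X.γ i t - E.θHat X i t

/-- Estimated line-of-sight rate, from the estimated relative kinematics `r̂ θ̂' = - V sin σ̂`. -/
noncomputable def θHatDot (i : Fin N) (t : ℝ) : ℝ :=
  -(E.V i * sin (E.σHat X i t)) / E.rHat X i t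

/-- The consensus term `(-ζ + η f'/f) ∑ j, [L_I] i j * e j`. -/
noncomputable def consensusTerm (tgod : ℝ → ℝ) (i : Fin N) (t : ℝ) : ℝ :=
  (-E.ζ + E.η * (scalingDot t E.te / scaling t E.te)) *
    ∑ j, digraphLaplacian E.A i j * E.err X tgod j t

/-- The cooperative guidance command. -/
noncomputable def command (tgod : ℝ → ℝ) (i : Fin N) (t : ℝ) : ℝ :=
  E.V i * E.θHatDot X i t
    + E.V i ^ 2 * E.k i * (cos (E.σHat X i t) - 1) / (E.rHat X i t * sin (2 * E.σHat X i t))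
    + E.V i ^ 2 * sin (E.σHat X i t) / (2 * E.rHat X i t)
    + E.V i ^ 2 * E.k i / (E.rHat X i t * sin (2 * E.σHat X i t)) * E.consensusTerm X tgod i t

/-- The relative estimation error
`a_{i0} (p̂_i - p) + ∑ j, a_{ij} (p̂_i - p̂_j)` used by the observer. -/
noncomputable def relErr (i : Fin N) (t : ℝ) : ℂ :=
  (digraphAdj E.S i.succ 0 : ℂ) * (X.est i t - E.target)
    + ∑ j : Fin N, (digraphAdj E.S i.succ j.succ : ℂ) * (X.est i t - X.est j t)

/-- `X` is a regular trajectory on `[0, T)` of the closed loop formed by the engagement kinematics,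
the distributed observer and the cooperative guidance command, the time-to-go errors being formed
with the desired time-to-go `tgod`. Regular means that no interceptor has reached the target and
that the denominators of the guidance command do not vanish. At the switching instants
`tp` and `te` of the scaling functions only continuity is required. -/
structure IsClosedLoop (tgod : ℝ → ℝ) (T : ℝ) : Prop where
  r_pos : ∀ i, ∀ t ∈ Ico 0 T, 0 < X.r i t
  rHat_ne : ∀ i, ∀ t ∈ Ico 0 T, E.rHat X i t ≠ 0
  sin_ne : ∀ i, ∀ t ∈ Ico 0 T, sin (2 * E.σHat X i t) ≠ 0
  r_cont : ∀ i, ContinuousOn (X.r i) (Ico 0 T)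
  θ_cont : ∀ i, ContinuousOn (X.θ i) (Ico 0 T)
  γ_cont : ∀ i, ContinuousOn (X.γ i) (Ico 0 T)
  est_cont : ∀ i, ContinuousOn (X.est i) (Ico 0 T)
  r_deriv : ∀ i, ∀ t ∈ Ioo 0 T \ {E.tp, E.te},
    HasDerivAt (X.r i) (-(E.V i * cos (X.γ i t - X.θ i t))) t
  θ_deriv : ∀ i, ∀ t ∈ Ioo 0 T \ {E.tp, E.te},
    HasDerivAt (X.θ i) (-(E.V i * sin (X.γ i t - X.θ i t)) / X.r i t) t
  γ_deriv : ∀ i, ∀ t ∈ Ioo 0 T \ {E.tp, E.te},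
    HasDerivAt (X.γ i) (E.command X tgod i t / E.V i) t
  est_deriv : ∀ i, ∀ t ∈ Ioo 0 T \ {E.tp, E.te},
    HasDerivAt (X.est i)
      (-(((E.α - E.β * (scalingDot t E.tp / scaling t E.tp) : ℝ) : ℂ) * E.relErr X i t)) t

end Engagement

/-! ### Monotonicity with finitely many exceptional points -/

theorem le_of_hasDerivAt_nonpos_off_finset {f f' : ℝ → ℝ} (s : Finset ℝ) :
    ∀ {a b : ℝ}, a ≤ b → ContinuousOn f (Icc a b) →
      (∀ t ∈ Ioo a b, t ∉ s → HasDerivAt f (f' t) t ∧ f' t ≤ 0) → f b ≤ f a := by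
  induction s using Finset.induction_on with
  | empty =>
    intro a b hab hc hd
    refine antitoneOn_of_deriv_nonpos (convex_Icc a b) hc ?_ ?_
      (left_mem_Icc.2 hab) (right_mem_Icc.2 hab) hab
    · intro t ht
      rw [interior_Icc] at ht
      exact (hd t ht (by simp)).1.differentiableAt.differentiableWithinAt
    · intro t ht
      rw [interior_Icc] at ht
      rw [(hd t ht (by simp)).1.deriv]
      exact (hd t ht (by simp)).2
  | insert c s _ ih =>
    intro a b hab hc hd
    by_cases hcab : c ∈ Ioo a b
    · have h1 : f c ≤ f a := ih hcab.1.le (hc.mono (Icc_subset_Icc_right hcab.2.le))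
        fun t ht hts => hd t ⟨ht.1, ht.2.trans hcab.2⟩ (by simp [hts, ht.2.ne])
      have h2 : f b ≤ f c := ih hcab.2.le (hc.mono (Icc_subset_Icc_left hcab.1.le))
        fun t ht hts => hd t ⟨hcab.1.trans ht.1, ht.2⟩ (by simp [hts, ht.1.ne'])
      exact h2.trans h1
    · exact ih hab hc fun t ht hts => hd t ht (by
        rw [Finset.mem_insert, not_or]
        exact ⟨fun h => hcab (h ▸ ht), hts⟩)

theorem eq_of_hasDerivAt_zero_off_finset {f : ℝ → ℝ} (s : Finset ℝ) {a b : ℝ} (hab : a ≤ b)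
    (hc : ContinuousOn f (Icc a b)) (hd : ∀ t ∈ Ioo a b, t ∉ s → HasDerivAt f 0 t) :
    f b = f a := by
  refine le_antisymm (le_of_hasDerivAt_nonpos_off_finset (f' := fun _ => 0) s hab hc
    fun t ht hts => ⟨hd t ht hts, le_rfl⟩) ?_
  have := le_of_hasDerivAt_nonpos_off_finset (f := fun t => -f t) (f' := fun _ => 0) s hab hc.neg
    fun t ht hts => ⟨by simpa using (hd t ht hts).fun_neg, le_rfl⟩
  linarith

/-! ### The scaling function -/

theorem scaling_neg {t c : ℝ} (hc : 0 < c) (ht : t < c) : scaling t c < 0 := by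
  rw [scaling, if_pos ht]
  have h1 : π / c * t = π - π / c * (c - t) := by field_simp; ring
  rw [h1, sin_pi_sub]
  have h2 : sin (π / c * (c - t)) < π / c * (c - t) :=
    sin_lt (mul_pos (div_pos pi_pos hc) (sub_pos.2 ht))
  have h3 : c / π * sin (π / c * (c - t)) < c / π * (π / c * (c - t)) :=
    mul_lt_mul_of_pos_left h2 (div_pos hc pi_pos)
  have h4 : c / π * (π / c * (c - t)) = c - t := by field_simp
  linarith

theorem scalingDot_nonneg (t c : ℝ) : 0 ≤ scalingDot t c := by
  unfold scalingDot
  split_ifs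
  · linarith [neg_one_le_cos (π / c * t)]
  · exact le_rfl

theorem scalingDot_of_le {t c : ℝ} (h : c ≤ t) : scalingDot t c = 0 := if_neg h.not_gt

theorem hasDerivAt_scaling {t c : ℝ} (hc : 0 < c) (ht : t < c) :
    HasDerivAt (fun t => scaling t c) (scalingDot t c) t := by
  have h : HasDerivAt (fun t : ℝ => c / π * sin (π / c * t) + t - c) (scalingDot t c) t := by
    have h1 : HasDerivAt (fun t : ℝ => π / c * t) (π / c) t := by
      simpa using (hasDerivAt_id t).const_mul (π / c)
    convert! ((h1.sin.const_mul (c / π)).add (hasDerivAt_id t)).sub_const c using 1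
    rw [scalingDot, if_pos ht]
    field_simp
  refine h.congr_of_eventuallyEq ?_
  filter_upwards [eventually_lt_nhds ht] with s hs
  simp [scaling, hs]

theorem tendsto_scaling {c : ℝ} (hc : 0 < c) :
    Tendsto (fun t => scaling t c) (𝓝[<] c) (𝓝[≠] 0) := by
  refine tendsto_nhdsWithin_iff.2 ⟨?_, ?_⟩
  · have h : Tendsto (fun t : ℝ => c / π * sin (π / c * t) + t - c) (𝓝[<] c)
        (𝓝 (c / π * sin (π / c * c) + c - c)) :=
      (Continuous.tendsto (by fun_prop) c).mono_left nhdsWithin_le_nhds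
    rw [div_mul_cancel₀ _ hc.ne', sin_pi] at h
    simp only [mul_zero, zero_add, sub_self] at h
    refine h.congr' ?_
    filter_upwards [self_mem_nhdsWithin] with t ht
    simp [scaling, mem_Iio.1 ht]
  · filter_upwards [self_mem_nhdsWithin] with t ht
    exact (scaling_neg hc ht).ne

theorem scalingDot_div_scaling_nonpos {t c : ℝ} (hc : 0 < c) :
    scalingDot t c / scaling t c ≤ 0 := by
  rcases lt_or_ge t c with h | h
  · exact div_nonpos_of_nonneg_of_nonpos (scalingDot_nonneg t c) (scaling_neg hc h).le
  · simp [scalingDot_of_le h]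

/-! ### Decay within a predefined time -/

/-- If `W ≥ 0` satisfies `W' ≤ p (f'/f) W` with `p > 0`, then `W` vanishes at the time `c`. -/
theorem tendsto_zero_of_scaling_decay {W W' : ℝ → ℝ} {t₀ c p : ℝ} (hc : 0 < c) (ht₀ : t₀ < c)
    (hp : 0 < p) (s : Finset ℝ) (hW : ∀ t, 0 ≤ W t) (hcont : ContinuousOn W (Ico t₀ c))
    (hder : ∀ t ∈ Ioo t₀ c, t ∉ s → HasDerivAt W (W' t) t ∧
      W' t ≤ p * (scalingDot t c / scaling t c) * W t) :
    Tendsto W (𝓝[<] c) (𝓝 0) := by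
  set U : ℝ → ℝ := fun t => W t * exp (-p * log (scaling t c)) with hU
  have hfac : ∀ t, t < c → HasDerivAt (fun t => exp (-p * log (scaling t c)))
      (exp (-p * log (scaling t c)) * (-p * (scalingDot t c / scaling t c))) t := fun t ht =>
    (((hasDerivAt_scaling hc ht).log (scaling_neg hc ht).ne).const_mul (-p)).exp
  have hUle : ∀ t ∈ Ico t₀ c, U t ≤ U t₀ := by
    intro t ht
    refine le_of_hasDerivAt_nonpos_off_finset (f' := fun t => W' t * exp (-p * log (scaling t c)) +
      W t * (exp (-p * log (scaling t c)) * (-p * (scalingDot t c / scaling t c)))) s ht.1 ?_ ?_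
    · refine (hcont.mono fun u hu => ⟨hu.1, hu.2.trans_lt ht.2⟩).mul ?_
      exact fun u hu => (hfac u (hu.2.trans_lt ht.2)).continuousAt.continuousWithinAt
    · intro u hu hus
      have huc : u < c := hu.2.trans ht.2
      obtain ⟨h1, h2⟩ := hder u ⟨hu.1, huc⟩ hus
      refine ⟨h1.mul (hfac u huc), ?_⟩
      have := mul_le_mul_of_nonneg_right h2 (exp_pos (-p * log (scaling u c))).le
      linarith
  have hle : ∀ t ∈ Ico t₀ c, W t ≤ U t₀ * exp (p * log (scaling t c)) := by
    intro t ht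
    have h1 : W t = U t * exp (p * log (scaling t c)) := by
      rw [hU]
      simp only
      rw [mul_assoc, ← exp_add]
      simp
    rw [h1]
    exact mul_le_mul_of_nonneg_right (hUle t ht) (exp_pos _).le
  have hlim : Tendsto (fun t => U t₀ * exp (p * log (scaling t c))) (𝓝[<] c) (𝓝 0) := by
    have h1 : Tendsto (fun t => log (scaling t c)) (𝓝[<] c) atBot :=
      tendsto_log_nhdsNE_zero.comp (tendsto_scaling hc)
    have h2 := (tendsto_exp_atBot.comp (h1.const_mul_atBot hp)).const_mul (U t₀)
    simpa using h2
  refine squeeze_zero' (Eventually.of_forall hW) ?_ hlim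
  filter_upwards [Ioo_mem_nhdsLT ht₀] with t ht
  exact hle t ⟨ht.1.le, ht.2⟩

/-- A linear flow `x' = -(a - b f'/f) L x` for which `∑ w x²` is a strict Lyapunov function of `L`
vanishes from the time `c` on; `y` stands for `L x`. -/
theorem vanish_of_scaled_flow {n : Type*} [Fintype n] {w : n → ℝ} (hw : ∀ i, 0 < w i)
    {x y : n → ℝ → ℝ} {a b c t₀ T δ : ℝ} (ha : 0 < a) (hb : 0 < b) (hδ : 0 < δ) (hc : 0 < c)
    (ht₀ : t₀ < c) (hcT : c ≤ T) (s : Finset ℝ) (hcont : ∀ i, ContinuousOn (x i) (Ico t₀ T))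
    (hder : ∀ i, ∀ t ∈ Ioo t₀ T, t ∉ s →
      HasDerivAt (x i) (-((a - b * (scalingDot t c / scaling t c)) * y i t)) t)
    (hco : ∀ t ∈ Ioo t₀ T, δ * ∑ i, w i * x i t ^ 2 ≤ 2 * ∑ i, w i * (x i t * y i t)) :
    (∀ i, Tendsto (x i) (𝓝[<] c) (𝓝 0)) ∧ ∀ i, ∀ t ∈ Ico c T, x i t = 0 := by
  set W : ℝ → ℝ := fun t => ∑ i, w i * x i t ^ 2 with hWdef
  set g : ℝ → ℝ := fun t => a - b * (scalingDot t c / scaling t c) with hg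
  have hW : ∀ t, 0 ≤ W t := fun t =>
    Finset.sum_nonneg fun i _ => mul_nonneg (hw i).le (sq_nonneg _)
  have hgpos : ∀ t, 0 < g t := fun t => by
    have := mul_nonpos_of_nonneg_of_nonpos hb.le (scalingDot_div_scaling_nonpos (t := t) hc)
    simp only [hg]
    linarith
  have hWcont : ContinuousOn W (Ico t₀ T) :=
    continuousOn_finsetSum _ fun i _ => ((hcont i).pow 2).const_smul (w i)
  have hWder : ∀ t ∈ Ioo t₀ T, t ∉ s →
      HasDerivAt W (-(g t * (2 * ∑ i, w i * (x i t * y i t)))) t := by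
    intro t ht hts
    have h : HasDerivAt W (∑ i, w i * (2 * x i t * -(g t * y i t))) t := by
      refine HasDerivAt.fun_sum fun i _ => ?_
      simpa using ((hder i t ht hts).pow 2).const_mul (w i)
    convert! h using 1
    simp only [Finset.mul_sum]
    rw [← Finset.sum_neg_distrib]
    exact Finset.sum_congr rfl fun i _ => by ring
  have hle : ∀ i t, x i t ^ 2 ≤ W t / w i := by
    intro i t
    rw [le_div_iff₀ (hw i), mul_comm]
    exact Finset.single_le_sum (f := fun i => w i * x i t ^ 2)
      (fun j _ => mul_nonneg (hw j).le (sq_nonneg _)) (Finset.mem_univ i)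
  have hWlim : Tendsto W (𝓝[<] c) (𝓝 0) := by
    refine tendsto_zero_of_scaling_decay hc ht₀ (mul_pos hδ hb) s hW
      (hWcont.mono (Ico_subset_Ico_right hcT)) (W' := fun t =>
        -(g t * (2 * ∑ i, w i * (x i t * y i t)))) ?_
    intro t ht hts
    have htT : t ∈ Ioo t₀ T := ⟨ht.1, ht.2.trans_le hcT⟩
    refine ⟨hWder t htT hts, ?_⟩
    have h1 := mul_le_mul_of_nonneg_left (hco t htT) (hgpos t).le
    have h2 : 0 ≤ a * (δ * W t) := mul_nonneg ha.le (mul_nonneg hδ.le (hW t))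
    have h3 : g t * (δ * W t) = a * (δ * W t) - δ * b * (scalingDot t c / scaling t c) * W t := by
      simp only [hg]
      ring
    linarith
  have hlim : ∀ i, Tendsto (x i) (𝓝[<] c) (𝓝 0) := by
    intro i
    have h1 : Tendsto (fun t => x i t ^ 2) (𝓝[<] c) (𝓝 0) :=
      squeeze_zero (fun t => sq_nonneg _) (hle i) (by simpa using hWlim.div_const (w i))
    have h2 := h1.sqrt
    simp only [sqrt_sq_eq_abs, sqrt_zero] at h2
    exact tendsto_zero_iff_abs_tendsto_zero _ |>.2 h2
  refine ⟨hlim, fun i t ht => ?_⟩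
  have hcmem : Ico t₀ T ∈ 𝓝 c := Ico_mem_nhds ht₀ (ht.1.trans_lt ht.2)
  have hWc : W c = 0 := tendsto_nhds_unique
    ((hWcont.continuousAt hcmem).tendsto.mono_left nhdsWithin_le_nhds) hWlim
  have hWt : W t ≤ W c := by
    refine le_of_hasDerivAt_nonpos_off_finset (f' := fun t =>
      -(g t * (2 * ∑ i, w i * (x i t * y i t)))) s ht.1
      (hWcont.mono fun u hu => ⟨ht₀.le.trans hu.1, hu.2.trans_lt ht.2⟩) ?_
    intro u hu hus
    have huT : u ∈ Ioo t₀ T := ⟨ht₀.trans hu.1, hu.2.trans ht.2⟩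
    refine ⟨hWder u huT hus, ?_⟩
    have h1 := hco u huT
    have h2 : 0 ≤ δ * W u := mul_nonneg hδ.le (hW u)
    have := mul_nonneg (hgpos u).le (h2.trans h1)
    linarith
  have h1 := hle i t
  have h2 : W t = 0 := le_antisymm (hWt.trans hWc.le) (hW t)
  rw [h2, zero_div] at h1
  exact pow_eq_zero_iff two_ne_zero |>.1 (le_antisymm h1 (sq_nonneg _))

/-! ### Global solutions of autonomous scalar equations -/

/-- Bounded and Lipschitz continuous. -/
def BoundedLipschitz (f : ℝ → ℝ) : Prop :=
  ∃ K, 0 < K ∧ (∀ x, |f x| ≤ K) ∧ ∀ x y, |f x - f y| ≤ K * |x - y|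

namespace BoundedLipschitz

variable {f g : ℝ → ℝ}

theorem const (c : ℝ) : BoundedLipschitz fun _ => c :=
  ⟨|c| + 1, by positivity, fun x => by simp, fun x y => by simp; positivity⟩

theorem sub (hf : BoundedLipschitz f) (hg : BoundedLipschitz g) :
    BoundedLipschitz fun x => f x - g x := by
  obtain ⟨K, hK, hK1, hK2⟩ := hf
  obtain ⟨M, hM, hM1, hM2⟩ := hg
  refine ⟨K + M, add_pos hK hM, fun x => (abs_sub _ _).trans (add_le_add (hK1 x) (hM1 x)),
    fun x y => ?_⟩
  have : f x - g x - (f y - g y) = (f x - f y) - (g x - g y) := by ring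
  rw [this, add_mul]
  exact (abs_sub _ _).trans (add_le_add (hK2 x y) (hM2 x y))

theorem add (hf : BoundedLipschitz f) (hg : BoundedLipschitz g) :
    BoundedLipschitz fun x => f x + g x := by
  simpa using hf.sub ((const 0).sub hg)

theorem mul (hf : BoundedLipschitz f) (hg : BoundedLipschitz g) :
    BoundedLipschitz fun x => f x * g x := by
  obtain ⟨K, hK, hK1, hK2⟩ := hf
  obtain ⟨M, hM, hM1, hM2⟩ := hg
  refine ⟨2 * K * M + K * M, by positivity, fun x => ?_, fun x y => ?_⟩
  · rw [abs_mul]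
    nlinarith [mul_le_mul (hK1 x) (hM1 x) (abs_nonneg _) hK.le, mul_pos hK hM]
  · have : f x * g x - f y * g y = (f x - f y) * g x + f y * (g x - g y) := by ring
    rw [this]
    refine (abs_add_le _ _).trans ?_
    rw [abs_mul, abs_mul]
    have h1 := mul_le_mul (hK2 x y) (hM1 x) (abs_nonneg _) (by positivity)
    have h2 := mul_le_mul (hK1 y) (hM2 x y) (abs_nonneg _) hK.le
    have h3 : 0 ≤ K * M * |x - y| := by positivity
    linarith

theorem inv {c : ℝ} (hf : BoundedLipschitz f) (hc : 0 < c) (h : ∀ x, c ≤ f x) :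
    BoundedLipschitz fun x => (f x)⁻¹ := by
  obtain ⟨K, hK, hK1, hK2⟩ := hf
  have hpos : ∀ x, 0 < f x := fun x => hc.trans_le (h x)
  refine ⟨c⁻¹ + K / c ^ 2, by positivity, fun x => ?_, fun x y => ?_⟩
  · rw [abs_of_pos (inv_pos.2 (hpos x))]
    have := inv_anti₀ hc (h x)
    have h2 : 0 < K / c ^ 2 := by positivity
    linarith
  · have e : (f x)⁻¹ - (f y)⁻¹ = (f y - f x) / (f x * f y) := by
      have := (hpos x).ne'
      have := (hpos y).ne'
      field_simp
    rw [e, abs_div, abs_of_pos (mul_pos (hpos x) (hpos y)), abs_sub_comm]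
    have h1 : c ^ 2 ≤ f x * f y := by
      rw [sq]
      exact mul_le_mul (h x) (h y) hc.le (hpos x).le
    have h2 : |f x - f y| / (f x * f y) ≤ K * |x - y| / c ^ 2 :=
      div_le_div₀ (by positivity) (hK2 x y) (by positivity) h1
    have h3 : 0 ≤ c⁻¹ * |x - y| := by positivity
    have h4 : K * |x - y| / c ^ 2 = K / c ^ 2 * |x - y| := by ring
    rw [add_mul]
    linarith

theorem max_const (hf : BoundedLipschitz f) (c : ℝ) : BoundedLipschitz fun x => max (f x) c := by
  obtain ⟨K, hK, hK1, hK2⟩ := hf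
  refine ⟨K + |c|, by positivity, fun x => ?_, fun x y => ?_⟩
  · refine (abs_max_le_max_abs_abs).trans (max_le ?_ ?_)
    · linarith [hK1 x, abs_nonneg c]
    · linarith
  · refine (abs_max_sub_max_le_abs _ _ _).trans ((hK2 x y).trans ?_)
    exact mul_le_mul_of_nonneg_right (by linarith [abs_nonneg c]) (abs_nonneg _)

theorem sin : BoundedLipschitz Real.sin :=
  ⟨1, one_pos, abs_sin_le_one, fun x y => by
    simpa [Real.dist_eq] using (Real.lipschitzWith_sin).dist_le_mul x y⟩

theorem cos : BoundedLipschitz Real.cos :=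
  ⟨1, one_pos, abs_cos_le_one, fun x y => by
    simpa [Real.dist_eq] using (Real.lipschitzWith_cos).dist_le_mul x y⟩

theorem lipschitzWith (hf : BoundedLipschitz f) : ∃ K, LipschitzWith K f := by
  obtain ⟨K, hK, -, hK2⟩ := hf
  exact ⟨⟨K, hK.le⟩, LipschitzWith.of_dist_le_mul fun x y => hK2 x y⟩

/-- An autonomous scalar equation with bounded Lipschitz right hand side is globally solvable. -/
theorem exists_global_solution (hf : BoundedLipschitz f) (s₀ x₀ : ℝ) :
    ∃ α : ℝ → ℝ, α s₀ = x₀ ∧ ∀ t, HasDerivAt α (f (α t)) t := by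
  obtain ⟨M, hM⟩ := hf.lipschitzWith
  obtain ⟨K, hK, hK1, -⟩ := hf
  have hex : ∀ n : ℕ, ∃ α : ℝ → ℝ, α s₀ = x₀ ∧
      ∀ t ∈ Ioo (s₀ - (n + 1)) (s₀ + (n + 1)), HasDerivAt α (f (α t)) t := by
    intro n
    have hn : (0 : ℝ) < n + 1 := by positivity
    have hpl : IsPicardLindelof (fun _ => f)
        (⟨s₀, by constructor <;> linarith⟩ : Icc (s₀ - (n + 1)) (s₀ + (n + 1))) x₀
        ⟨K * (n + 1), by positivity⟩ 0 ⟨K, hK.le⟩ M :=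
      { lipschitzOnWith := fun _ _ => hM.lipschitzOnWith
        continuousOn := fun _ _ => continuousOn_const
        norm_le := fun _ _ x _ => hK1 x
        mul_max_le := by simp; rfl }
    obtain ⟨α, h1, h2⟩ := hpl.exists_eq_forall_mem_Icc_hasDerivWithinAt₀
    exact ⟨α, h1, fun t ht => (h2 t (Ioo_subset_Icc_self ht)).hasDerivAt (Icc_mem_nhds ht.1 ht.2)⟩
  choose α h1 h2 using hex
  have hagree : ∀ m n : ℕ, m ≤ n → EqOn (α m) (α n) (Ioo (s₀ - (m + 1)) (s₀ + (m + 1))) := by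
    intro m n hmn
    have hmn' : (m : ℝ) ≤ n := Nat.cast_le.2 hmn
    have hm : (0 : ℝ) ≤ m := m.cast_nonneg
    refine ODE_solution_unique_of_mem_Ioo (v := fun _ => f) (s := fun _ => univ) (K := M)
      (t₀ := s₀) (fun t _ => hM.lipschitzOnWith) ⟨by linarith, by linarith⟩
      (fun t ht => ⟨h2 m t ht, trivial⟩)
      (fun t ht => ⟨h2 n t ⟨by linarith [ht.1], by linarith [ht.2]⟩, trivial⟩) ?_
    rw [h1, h1]
  have hmem : ∀ t, t ∈ Ioo (s₀ - (⌈|t - s₀|⌉₊ + 1)) (s₀ + (⌈|t - s₀|⌉₊ + 1)) := by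
    intro t
    have := abs_le.1 (Nat.le_ceil |t - s₀|)
    constructor <;> linarith [this.1, this.2]
  refine ⟨fun t => α ⌈|t - s₀|⌉₊ t, h1 _, fun t => ?_⟩
  refine (h2 _ t (hmem t)).congr_of_eventuallyEq ?_
  filter_upwards [isOpen_Ioo.mem_nhds (hmem t)] with u hu
  rcases le_total ⌈|u - s₀|⌉₊ ⌈|t - s₀|⌉₊ with h | h
  · exact hagree _ _ h (hmem u)
  · exact (hagree _ _ h hu).symm

end BoundedLipschitz

/-! ### Quadratic forms of Laplacians -/

section Laplacian

variable {n : Type*} [Fintype n] [DecidableEq n]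

theorem sum_weightLaplacian_mul (W : Matrix n n ℝ) (x : n → ℝ) (i : n) :
    ∑ j, weightLaplacian W i j * x j = ∑ j, W i j * (x i - x j) := by
  simp only [weightLaplacian, Matrix.sub_apply, sub_mul, mul_sub, Finset.sum_sub_distrib]
  congr 1
  rw [Finset.sum_eq_single i]
  · rw [Matrix.diagonal_apply_eq, Finset.sum_mul]
  · intro j _ hj
    rw [Matrix.diagonal_apply_ne' _ hj, zero_mul]
  · simp

theorem two_mul_weightLaplacian (W : Matrix n n ℝ) (x : n → ℝ) (i : n) :
    2 * (x i * ∑ j, weightLaplacian W i j * x j) =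
      ∑ j, weightLaplacian W i j * x j ^ 2 + ∑ j, W i j * (x i - x j) ^ 2 := by
  rw [sum_weightLaplacian_mul, sum_weightLaplacian_mul W (fun j => x j ^ 2), Finset.mul_sum,
    Finset.mul_sum, ← Finset.sum_add_distrib]
  exact Finset.sum_congr rfl fun j _ => by ring

omit [DecidableEq n] in
/-- Along a directed path differences are controlled by a quadratic form which is positive on
edges. -/
theorem exists_sq_sub_le_of_path {G : Digraph n} {P : n → n → ℝ} (hP : ∀ i j, 0 ≤ P i j)
    (hG : ∀ i j, G.Adj i j → i ≠ j → 0 < P j i) {i j : n} (h : Relation.ReflTransGen G.Adj i j) :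
    ∃ c, 0 ≤ c ∧ ∀ x : n → ℝ, (x i - x j) ^ 2 ≤ c * ∑ k, ∑ l, P k l * (x k - x l) ^ 2 := by
  have hQ : ∀ x : n → ℝ, 0 ≤ ∑ k, ∑ l, P k l * (x k - x l) ^ 2 := fun x =>
    Finset.sum_nonneg fun k _ => Finset.sum_nonneg fun l _ => mul_nonneg (hP k l) (sq_nonneg _)
  induction h with
  | refl => exact ⟨0, le_rfl, fun x => by simp⟩
  | @tail u v _ huv ih =>
    obtain ⟨c, hc, ih⟩ := ih
    by_cases huv' : u = v
    · subst huv'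
      exact ⟨c, hc, ih⟩
    have hp := hG u v huv huv'
    refine ⟨2 * c + 2 / P v u, by positivity, fun x => ?_⟩
    have h1 : P v u * (x v - x u) ^ 2 ≤ ∑ k, ∑ l, P k l * (x k - x l) ^ 2 :=
      (Finset.single_le_sum (f := fun l => P v l * (x v - x l) ^ 2)
        (fun l _ => mul_nonneg (hP v l) (sq_nonneg _)) (Finset.mem_univ u)).trans
      (Finset.single_le_sum (f := fun k => ∑ l, P k l * (x k - x l) ^ 2)
        (fun k _ => Finset.sum_nonneg fun l _ => mul_nonneg (hP k l) (sq_nonneg _))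
        (Finset.mem_univ v))
    have h2 : (x v - x u) ^ 2 ≤ (∑ k, ∑ l, P k l * (x k - x l) ^ 2) / P v u := by
      rw [le_div_iff₀ hp, mul_comm]
      exact h1
    have h3 : (x i - x v) ^ 2 ≤ 2 * (x i - x u) ^ 2 + 2 * (x v - x u) ^ 2 := by
      nlinarith [sq_nonneg (x i - x u + (x v - x u))]
    have h4 := ih x
    calc (x i - x v) ^ 2 ≤ 2 * (x i - x u) ^ 2 + 2 * (x v - x u) ^ 2 := h3
      _ ≤ 2 * (c * ∑ k, ∑ l, P k l * (x k - x l) ^ 2)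
          + 2 * ((∑ k, ∑ l, P k l * (x k - x l) ^ 2) / P v u) := by linarith
      _ = _ := by ring

omit [DecidableEq n] in
theorem exists_sq_sub_le {G : Digraph n} (hA : StronglyConnected G) {P : n → n → ℝ}
    (hP : ∀ i j, 0 ≤ P i j) (hG : ∀ i j, G.Adj i j → i ≠ j → 0 < P j i) :
    ∃ c, 0 ≤ c ∧ ∀ (x : n → ℝ) i j,
      (x i - x j) ^ 2 ≤ c * ∑ k, ∑ l, P k l * (x k - x l) ^ 2 := by
  choose c hc h using fun i j => exists_sq_sub_le_of_path hP hG (hA i j)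
  refine ⟨∑ i, ∑ j, c i j, Finset.sum_nonneg fun i _ => Finset.sum_nonneg fun j _ => hc i j,
    fun x i j => (h i j x).trans (mul_le_mul_of_nonneg_right ?_ ?_)⟩
  · exact (Finset.single_le_sum (f := fun j => c i j) (fun j _ => hc i j)
      (Finset.mem_univ j)).trans (Finset.single_le_sum (f := fun i => ∑ j, c i j)
      (fun i _ => Finset.sum_nonneg fun j _ => hc i j) (Finset.mem_univ i))
  · exact Finset.sum_nonneg fun k _ => Finset.sum_nonneg fun l _ =>
      mul_nonneg (hP k l) (sq_nonneg _)

omit [Fintype n] [DecidableEq n] in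
theorem digraphAdj_nonneg (G : Digraph n) (i j : n) : 0 ≤ digraphAdj G i j := by
  simp only [digraphAdj, Matrix.of_apply]
  split_ifs <;> norm_num

omit [Fintype n] [DecidableEq n] in
theorem digraphAdj_eq_one {G : Digraph n} {i j : n} (h : G.Adj i j) (hij : i ≠ j) :
    digraphAdj G j i = 1 := by
  simp [digraphAdj, h, hij.symm]

/-- The Laplacian of a strongly connected digraph has a positive left null vector. -/
theorem exists_pos_left_null [Nonempty n] {G : Digraph n} (hA : StronglyConnected G) :
    ∃ ν : n → ℝ, (∀ i, 0 < ν i) ∧ ∑ i, ν i = 1 ∧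
      ∀ x : n → ℝ, ∑ i, ν i * ∑ j, digraphLaplacian G i j * x j = 0 := by
  set W := digraphAdj G with hW
  have hW0 : ∀ i j, 0 ≤ W i j := digraphAdj_nonneg G
  have hdet : (digraphLaplacian G).det = 0 := by
    refine Matrix.exists_mulVec_eq_zero_iff.1 ⟨fun _ => 1, ?_, ?_⟩
    · exact fun h => one_ne_zero (congrFun h (Classical.arbitrary n))
    · ext i
      exact (sum_weightLaplacian_mul W (fun _ => 1) i).trans (by simp)
  obtain ⟨v, hv0, hv⟩ := Matrix.exists_vecMul_eq_zero_iff.2 hdet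
  have hcol : ∀ (u : n → ℝ) j, ∑ i, u i * digraphLaplacian G i j =
      u j * ∑ k, W j k - ∑ i, u i * W i j := by
    intro u j
    simp only [digraphLaplacian, weightLaplacian, Matrix.sub_apply, mul_sub,
      Finset.sum_sub_distrib]
    congr 1
    rw [Finset.sum_eq_single j]
    · rw [Matrix.diagonal_apply_eq]
    · intro i _ hi
      rw [Matrix.diagonal_apply_ne _ hi, mul_zero]
    · simp
  have hvj : ∀ j, v j * ∑ k, W j k = ∑ i, v i * W i j := fun j => by
    have h1 := congrFun hv j
    have h2 := hcol v j
    simp only [Matrix.vecMul, dotProduct, Pi.zero_apply] at h1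
    linarith
  have hle : ∀ j ∈ Finset.univ, |v j| * ∑ k, W j k ≤ ∑ i, |v i| * W i j := by
    intro j _
    have h0 : 0 ≤ ∑ k, W j k := Finset.sum_nonneg fun k _ => hW0 j k
    rw [← abs_of_nonneg h0, ← abs_mul, hvj]
    refine (Finset.abs_sum_le_sum_abs _ _).trans (Finset.sum_le_sum fun i _ => ?_)
    rw [abs_mul, abs_of_nonneg (hW0 i j)]
  have hsum : ∑ j, |v j| * ∑ k, W j k = ∑ j, ∑ i, |v i| * W i j := by
    rw [Finset.sum_comm]
    exact Finset.sum_congr rfl fun j _ => Finset.mul_sum _ _ _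
  have habs : ∀ j, |v j| * ∑ k, W j k = ∑ i, |v i| * W i j := fun j =>
    (Finset.sum_eq_sum_iff_of_le hle).1 hsum j (Finset.mem_univ j)
  have hstep : ∀ k j, G.Adj k j → 0 < |v j| → 0 < |v k| := by
    intro k j hkj hj
    by_cases h : k = j
    · rwa [h]
    have h1 : |v j| * W j k ≤ ∑ i, |v i| * W i k :=
      Finset.single_le_sum (f := fun i => |v i| * W i k)
        (fun i _ => mul_nonneg (abs_nonneg _) (hW0 i k)) (Finset.mem_univ j)
    rw [← habs k, hW, digraphAdj_eq_one hkj h, mul_one] at h1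
    exact pos_of_mul_pos_left (hj.trans_le h1) (Finset.sum_nonneg fun l _ => hW0 k l)
  obtain ⟨j₀, hj₀⟩ := Function.ne_iff.1 hv0
  have hpos : ∀ k, 0 < |v k| := by
    intro k
    induction hA k j₀ using Relation.ReflTransGen.head_induction_on with
    | refl => exact abs_pos.2 hj₀
    | head h _ ih => exact hstep _ _ h ih
  have hs : 0 < ∑ i, |v i| := Finset.sum_pos (fun i _ => hpos i) Finset.univ_nonempty
  refine ⟨fun i => |v i| / ∑ i, |v i|, fun i => div_pos (hpos i) hs, ?_, fun x => ?_⟩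
  · rw [← Finset.sum_div, div_self hs.ne']
  · have h1 : ∑ i, |v i| * ∑ j, digraphLaplacian G i j * x j = 0 := by
      simp only [Finset.mul_sum]
      rw [Finset.sum_comm]
      refine Finset.sum_eq_zero fun j _ => ?_
      have := hcol (fun i => |v i|) j
      rw [habs j, sub_self] at this
      simp only [← mul_assoc, ← Finset.sum_mul, this, zero_mul]
    simp only [div_mul_eq_mul_div, ← Finset.sum_div, h1, zero_div]

/-- Lyapunov inequality for the disagreement of a strongly connected digraph. -/
theorem exists_consensus_lyapunov [Nonempty n] {G : Digraph n} (hA : StronglyConnected G) :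
    ∃ (ν : n → ℝ) (δ : ℝ), (∀ i, 0 < ν i) ∧ ∑ i, ν i = 1 ∧ 0 < δ ∧
      (∀ x : n → ℝ, ∑ i, ν i * ∑ j, digraphLaplacian G i j * x j = 0) ∧
      ∀ x : n → ℝ, ∑ i, ν i * x i = 0 → δ * ∑ i, ν i * x i ^ 2 ≤
        2 * ∑ i, ν i * (x i * ∑ j, digraphLaplacian G i j * x j) := by
  obtain ⟨ν, hν, hν1, hν0⟩ := exists_pos_left_null hA
  obtain ⟨c, hc, hcb⟩ := exists_sq_sub_le hA (P := fun i j => ν i * digraphAdj G i j)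
    (fun i j => mul_nonneg (hν i).le (digraphAdj_nonneg G i j)) (fun i j h hij => by
      simpa [digraphAdj_eq_one h hij] using hν j)
  refine ⟨ν, 1 / (c + 1), hν, hν1, by positivity, hν0, fun x hx => ?_⟩
  have hQ : 2 * ∑ i, ν i * (x i * ∑ j, digraphLaplacian G i j * x j) =
      ∑ k, ∑ l, ν k * digraphAdj G k l * (x k - x l) ^ 2 := by
    have h1 : ∀ i, 2 * (ν i * (x i * ∑ j, digraphLaplacian G i j * x j)) =
        ν i * ∑ j, digraphLaplacian G i j * x j ^ 2
          + ∑ l, ν i * digraphAdj G i l * (x i - x l) ^ 2 := fun i => by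
      have := two_mul_weightLaplacian (digraphAdj G) x i
      rw [mul_left_comm, digraphLaplacian, this, mul_add, Finset.mul_sum (f := fun j =>
        digraphAdj G i j * (x i - x j) ^ 2)]
      simp only [mul_assoc]
    rw [Finset.mul_sum, Finset.sum_congr rfl fun i _ => h1 i, Finset.sum_add_distrib,
      hν0 fun j => x j ^ 2, zero_add]
  rw [hQ]
  set Q := ∑ k, ∑ l, ν k * digraphAdj G k l * (x k - x l) ^ 2
  have hQ0 : 0 ≤ Q := Finset.sum_nonneg fun k _ => Finset.sum_nonneg fun l _ =>
    mul_nonneg (mul_nonneg (hν k).le (digraphAdj_nonneg G k l)) (sq_nonneg _)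
  have hi : ∀ i, x i ^ 2 + ∑ j, ν j * x j ^ 2 ≤ c * Q := by
    intro i
    have h1 : ∑ j, ν j * (x i - x j) ^ 2 ≤ ∑ j, ν j * (c * Q) :=
      Finset.sum_le_sum fun j _ => mul_le_mul_of_nonneg_left (hcb x i j) (hν j).le
    rw [← Finset.sum_mul, hν1, one_mul] at h1
    have h2 : ∑ j, ν j * (x i - x j) ^ 2 =
        x i ^ 2 * ∑ j, ν j - 2 * x i * ∑ j, ν j * x j + ∑ j, ν j * x j ^ 2 := by
      rw [Finset.mul_sum, Finset.mul_sum, ← Finset.sum_sub_distrib, ← Finset.sum_add_distrib]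
      exact Finset.sum_congr rfl fun j _ => by ring
    rw [h2, hν1, hx] at h1
    linarith
  have h3 : ∑ j, ν j * x j ^ 2 ≤ c * Q := by
    obtain ⟨i⟩ := ‹Nonempty n›
    linarith [hi i, sq_nonneg (x i)]
  rw [one_div, inv_mul_le_iff₀ (by positivity)]
  linarith

end Laplacian

theorem mirrorLambda2_pos {N : ℕ} (hN : 2 ≤ N) {G : Digraph (Fin N)} (hA : StronglyConnected G) :
    0 < mirrorLambda2 hN G := by
  by_contra hneg
  rw [not_lt] at hneg
  set hH := mirrorLaplacian_isHermitian G with hHdef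
  set P : Fin N → Fin N → ℝ := fun i j => (digraphAdj G i j + digraphAdj G j i) / 2 with hPdef
  have hP : ∀ i j, 0 ≤ P i j := fun i j =>
    div_nonneg (add_nonneg (digraphAdj_nonneg G i j) (digraphAdj_nonneg G j i)) two_pos.le
  obtain ⟨c, hc, hcb⟩ := exists_sq_sub_le hA (P := P) hP fun i j h hij => by
    have h1 := digraphAdj_eq_one h hij
    have h2 := digraphAdj_nonneg G i j
    simp only [hPdef]
    linarith
  have hform : ∀ x : Fin N → ℝ, 2 * ∑ i, x i * ∑ j, mirrorLaplacian G i j * x j =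
      ∑ k, ∑ l, P k l * (x k - x l) ^ 2 := by
    intro x
    have h0 : ∑ i, ∑ j, mirrorLaplacian G i j * x j ^ 2 = 0 := by
      have h1 : ∀ i, ∑ j, mirrorLaplacian G i j * x j ^ 2 = ∑ j, P i j * (x i ^ 2 - x j ^ 2) :=
        fun i => sum_weightLaplacian_mul (Matrix.of P) (fun j => x j ^ 2) i
      simp only [h1, mul_sub, Finset.sum_sub_distrib]
      rw [sub_eq_zero, Finset.sum_comm]
      refine Finset.sum_congr rfl fun i _ => Finset.sum_congr rfl fun j _ => ?_
      simp only [hPdef]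
      ring
    have h2 : ∀ i, 2 * (x i * ∑ j, mirrorLaplacian G i j * x j) =
        ∑ j, mirrorLaplacian G i j * x j ^ 2 + ∑ l, P i l * (x i - x l) ^ 2 := fun i =>
      two_mul_weightLaplacian (Matrix.of P) x i
    rw [Finset.mul_sum, Finset.sum_congr rfl fun i _ => h2 i, Finset.sum_add_distrib, h0, zero_add]
  have hconst : ∀ k, hH.eigenvalues k ≤ 0 → ∀ i j,
      hH.eigenvectorBasis k i = hH.eigenvectorBasis k j := by
    intro k hk i j
    have h1 := hform (hH.eigenvectorBasis k)
    have h2 : ∀ i, ∑ j, mirrorLaplacian G i j * hH.eigenvectorBasis k j =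
        hH.eigenvalues k * hH.eigenvectorBasis k i := fun i =>
      congrFun (hH.mulVec_eigenvectorBasis k) i
    have h3 : 2 * ∑ i, hH.eigenvectorBasis k i * ∑ j, mirrorLaplacian G i j *
        hH.eigenvectorBasis k j ≤ 0 := by
      refine mul_nonpos_of_nonneg_of_nonpos two_pos.le (Finset.sum_nonpos fun i _ => ?_)
      rw [h2]
      have := mul_nonpos_of_nonpos_of_nonneg hk (mul_self_nonneg (hH.eigenvectorBasis k i))
      linarith
    rw [h1] at h3
    have h4 := hcb (hH.eigenvectorBasis k) i j
    have h5 := mul_nonpos_of_nonneg_of_nonpos hc h3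
    have h6 := pow_eq_zero_iff two_ne_zero |>.1 (le_antisymm (h4.trans h5) (sq_nonneg _))
    linarith
  have hcard : Fintype.card (Fin N) = N := Fintype.card_fin N
  set e : Fin (Fintype.card (Fin N)) ≃ Fin N := Fintype.equivOfCardEq (Fintype.card_fin _)
  have heig : ∀ m, hH.eigenvalues (e m) = hH.eigenvalues₀ m := fun m =>
    congrArg hH.eigenvalues₀ (e.symm_apply_apply m)
  set m₁ : Fin (Fintype.card (Fin N)) := ⟨N - 2, by omega⟩
  set m₂ : Fin (Fintype.card (Fin N)) := ⟨N - 1, by omega⟩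
  have hm : m₁ ≤ m₂ := Fin.mk_le_mk.2 (by omega)
  have hm' : m₁ ≠ m₂ := fun h => by
    have := congrArg Fin.val h
    simp only [m₁, m₂] at this
    omega
  have h1 : hH.eigenvalues (e m₁) ≤ 0 := by
    rw [heig]
    exact hneg
  have h2 : hH.eigenvalues (e m₂) ≤ 0 := by
    rw [heig]
    exact (hH.eigenvalues₀_antitone hm).trans hneg
  have hon := hH.eigenvectorBasis.orthonormal
  have hinner : inner ℝ (hH.eigenvectorBasis (e m₁)) (hH.eigenvectorBasis (e m₂)) = (0 : ℝ) :=
    hon.2 (e.injective.ne hm')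
  have hzero : ∀ k, hH.eigenvalues k ≤ 0 → hH.eigenvectorBasis k ⟨0, by omega⟩ ≠ 0 := by
    intro k hk h0
    refine hon.ne_zero k ?_
    ext i
    rw [hconst k hk i ⟨0, by omega⟩, h0]
    rfl
  rw [PiLp.inner_apply] at hinner
  simp only [hconst _ h1 _ ⟨0, by omega⟩, hconst _ h2 _ ⟨0, by omega⟩, Finset.sum_const,
    Finset.card_univ, hcard, nsmul_eq_mul, RCLike.inner_apply, conj_trivial] at hinner
  rcases mul_eq_zero.1 hinner with h | h
  · have : N = 0 := by exact_mod_cast h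
    omega
  · rcases mul_eq_zero.1 h with h | h
    · exact hzero _ h2 h
    · exact hzero _ h1 h

/-! ### The sensing graph -/

section Sensing

variable {N : ℕ} {S : Digraph (Fin (N + 1))}

theorem sum_reducedLaplacian_mul (S : Digraph (Fin (N + 1))) (x : Fin N → ℝ) (i : Fin N) :
    ∑ j, reducedLaplacian S i j * x j = digraphAdj S i.succ 0 * x i +
      ∑ j : Fin N, digraphAdj S i.succ j.succ * (x i - x j) := by
  have h := sum_weightLaplacian_mul (digraphAdj S) (Fin.cons 0 x : Fin (N + 1) → ℝ) i.succ
  rw [Fin.sum_univ_succ, Fin.sum_univ_succ] at h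
  simp only [Fin.cons_zero, Fin.cons_succ, mul_zero, zero_add, sub_zero] at h
  exact h

theorem nonneg_of_reducedLaplacian_nonneg (hroot : ∀ i, Relation.ReflTransGen S.Adj 0 i)
    {x : Fin N → ℝ} (hx : ∀ i, 0 ≤ ∑ j, reducedLaplacian S i j * x j) (i : Fin N) : 0 ≤ x i := by
  set X : Fin (N + 1) → ℝ := Fin.cons 0 x with hX
  obtain ⟨m, hm⟩ := Finite.exists_min X
  have key : ∀ v, Relation.ReflTransGen S.Adj 0 v → X v = X m → X 0 = X m := by
    intro v hv
    induction hv with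
    | refl => exact id
    | @tail u v _ huv ih =>
      intro hvm
      by_cases huv' : u = v
      · exact ih (huv' ▸ hvm)
      refine Fin.cases (motive := fun v => X v = X m → S.Adj u v → u ≠ v → X 0 = X m)
        (fun h _ _ => h) (fun k hk hadj hne => ih ?_) v hvm huv huv'
      have h1 : ∑ j, digraphAdj S k.succ j * (X k.succ - X j) =
          ∑ j, reducedLaplacian S k j * x j := by
        rw [sum_reducedLaplacian_mul, Fin.sum_univ_succ]
        simp [hX]
      have h2 : ∀ j ∈ Finset.univ, digraphAdj S k.succ j * (X k.succ - X j) ≤ 0 := fun j _ =>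
        mul_nonpos_of_nonneg_of_nonpos (digraphAdj_nonneg S _ _) (by linarith [hm j])
      have h3 := (Finset.sum_eq_zero_iff_of_nonpos h2).1
        (le_antisymm (Finset.sum_nonpos h2) (h1 ▸ hx k)) u (Finset.mem_univ u)
      rw [digraphAdj_eq_one hadj hne, one_mul] at h3
      linarith
  have h0 := key m (hroot m) rfl
  have h1 := hm i.succ
  rw [← h0] at h1
  simpa [hX] using h1

theorem isUnit_reducedLaplacian (hroot : ∀ i, Relation.ReflTransGen S.Adj 0 i) :
    IsUnit (reducedLaplacian S).det := by
  rw [isUnit_iff_ne_zero]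
  intro h
  obtain ⟨v, hv0, hv⟩ := Matrix.exists_mulVec_eq_zero_iff.2 h
  have hv' : ∀ i, ∑ j, reducedLaplacian S i j * v j = 0 := fun i => congrFun hv i
  refine hv0 (funext fun i => le_antisymm ?_ ?_)
  · have := nonneg_of_reducedLaplacian_nonneg hroot (x := fun j => -v j)
      (fun i => by simp [hv' i]) i
    simpa using this
  · exact nonneg_of_reducedLaplacian_nonneg hroot (fun i => (hv' i).ge) i

/-- The diagonal of `observerM`. -/
noncomputable def observerWeight (S : Digraph (Fin (N + 1))) : Fin N → ℝ :=
  ((reducedLaplacian S).transpose)⁻¹.mulVec fun _ => 1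

theorem sum_observerWeight_mul (hroot : ∀ i, Relation.ReflTransGen S.Adj 0 i) (x : Fin N → ℝ) :
    ∑ i, observerWeight S i * ∑ j, reducedLaplacian S i j * x j = ∑ i, x i := by
  have h : (reducedLaplacian S).transpose.mulVec (observerWeight S) = fun _ => 1 := by
    rw [observerWeight, Matrix.mulVec_mulVec, Matrix.mul_nonsing_inv _ (by
      rw [Matrix.det_transpose]; exact isUnit_reducedLaplacian hroot), Matrix.one_mulVec]
  simp only [Finset.mul_sum]
  rw [Finset.sum_comm]
  refine Finset.sum_congr rfl fun j _ => ?_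
  have hj : ∑ i, reducedLaplacian S i j * observerWeight S i = 1 := congrFun h j
  calc ∑ i, observerWeight S i * (reducedLaplacian S i j * x j)
      = (∑ i, reducedLaplacian S i j * observerWeight S i) * x j := by
        rw [Finset.sum_mul]
        exact Finset.sum_congr rfl fun i _ => by ring
    _ = x j := by rw [hj, one_mul]

theorem observerWeight_pos (hroot : ∀ i, Relation.ReflTransGen S.Adj 0 i) (k : Fin N) :
    0 < observerWeight S k := by
  set x := (reducedLaplacian S)⁻¹.mulVec (Pi.single k 1) with hxdef
  have hx : ∀ i, ∑ j, reducedLaplacian S i j * x j = (Pi.single k 1 : Fin N → ℝ) i := by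
    intro i
    have : (reducedLaplacian S).mulVec x = Pi.single k 1 := by
      rw [hxdef, Matrix.mulVec_mulVec, Matrix.mul_nonsing_inv _ (isUnit_reducedLaplacian hroot),
        Matrix.one_mulVec]
    exact congrFun this i
  have hx0 : ∀ i, 0 ≤ x i := nonneg_of_reducedLaplacian_nonneg hroot fun i => by
    rw [hx]
    by_cases h : i = k
    · subst h; simp
    · simp [h]
  have h := sum_observerWeight_mul hroot x
  simp only [hx, Pi.single_apply, mul_ite, mul_one, mul_zero, Finset.sum_ite_eq',
    Finset.mem_univ, if_true] at h
  rw [h]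
  refine lt_of_le_of_ne (Finset.sum_nonneg fun i _ => hx0 i) fun h0 => ?_
  have h1 := (Finset.sum_eq_zero_iff_of_nonneg fun i _ => hx0 i).1 h0.symm
  have h2 := hx k
  simp [h1] at h2

theorem sum_sq_le_observerC (hroot : ∀ i, Relation.ReflTransGen S.Adj 0 i) (x : Fin N → ℝ) :
    ∑ i, x i ^ 2 ≤ 2 * ∑ i, observerWeight S i * (x i * ∑ j, reducedLaplacian S i j * x j) := by
  rw [← sum_observerWeight_mul hroot fun i => x i ^ 2, Finset.mul_sum]
  refine Finset.sum_le_sum fun i _ => ?_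
  rw [mul_left_comm]
  refine mul_le_mul_of_nonneg_left ?_ (observerWeight_pos hroot i).le
  rw [sum_reducedLaplacian_mul, sum_reducedLaplacian_mul, mul_add, mul_add, Finset.mul_sum,
    Finset.mul_sum]
  have h1 : ∑ j : Fin N, digraphAdj S i.succ j.succ * (x i ^ 2 - x j ^ 2) ≤
      ∑ j : Fin N, 2 * (x i * (digraphAdj S i.succ j.succ * (x i - x j))) := by
    refine Finset.sum_le_sum fun j _ => ?_
    nlinarith [mul_nonneg (digraphAdj_nonneg S i.succ j.succ) (sq_nonneg (x i - x j))]
  have h2 := mul_nonneg (digraphAdj_nonneg S i.succ 0) (sq_nonneg (x i))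
  linarith

theorem posDef_observerM (hroot : ∀ i, Relation.ReflTransGen S.Adj 0 i) :
    (observerM S).PosDef :=
  Matrix.PosDef.diagonal (observerWeight_pos hroot)

theorem posDef_observerC (hroot : ∀ i, Relation.ReflTransGen S.Adj 0 i) :
    (observerC S).PosDef := by
  have hM : (observerM S).transpose = observerM S := Matrix.diagonal_transpose _
  refine Matrix.PosDef.of_dotProduct_mulVec_pos ?_ fun x hx => ?_
  · rw [Matrix.IsHermitian, Matrix.conjTranspose_eq_transpose_of_trivial, observerC,
      Matrix.transpose_add, Matrix.transpose_mul, Matrix.transpose_mul, hM,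
      Matrix.transpose_transpose, add_comm]
  · have h1 : 0 < ∑ i, x i ^ 2 := by
      obtain ⟨i, hi⟩ := Function.ne_iff.1 hx
      exact Finset.sum_pos' (fun i _ => sq_nonneg _) ⟨i, Finset.mem_univ i, by
        have : x i ≠ 0 := hi
        positivity⟩
    refine h1.trans_le ((sum_sq_le_observerC hroot x).trans (le_of_eq ?_))
    have h2 : ∀ y : Fin N → ℝ, (observerM S).mulVec y = fun i => observerWeight S i * y i :=
      fun y => funext fun i => Matrix.mulVec_diagonal _ _ _
    rw [observerC, Matrix.add_mulVec, dotProduct_add, ← Matrix.mulVec_mulVec,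
      ← Matrix.mulVec_mulVec, Matrix.mulVec_transpose, dotProduct_comm _ (Matrix.vecMul _ _),
      ← Matrix.dotProduct_mulVec, h2, h2]
    simp only [dotProduct, Matrix.mulVec, star_trivial]
    rw [two_mul]
    congr 1
    · exact Finset.sum_congr rfl fun i _ => by ring
    · exact Finset.sum_congr rfl fun i _ => by ring

theorem eigMax_pos (hN : 0 < N) {A : Matrix (Fin N) (Fin N) ℝ} (hA : A.PosDef) : 0 < eigMax A := by
  rw [eigMax, hA.1.spectrum_real_eq_range_eigenvalues]
  exact (hA.eigenvalues_pos ⟨0, hN⟩).trans_le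
    (le_csSup (Set.finite_range _).bddAbove (Set.mem_range_self _))

theorem eigMin_pos (hN : 0 < N) {A : Matrix (Fin N) (Fin N) ℝ} (hA : A.PosDef) : 0 < eigMin A := by
  rw [eigMin, hA.1.spectrum_real_eq_range_eigenvalues]
  obtain ⟨i, hi⟩ := (Set.range_nonempty_iff_nonempty.2 ⟨(⟨0, hN⟩ : Fin N)⟩).csInf_mem
    (Set.finite_range hA.1.eigenvalues)
  rw [← hi]
  exact hA.eigenvalues_pos i

theorem observer_gain_pos (hN : 0 < N) (hroot : ∀ i, Relation.ReflTransGen S.Adj 0 i) {β : ℝ}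
    (hβ : 2 * eigMax (observerM S) / eigMin (observerC S) ≤ β) : 0 < β :=
  (div_pos (mul_pos two_pos (eigMax_pos hN (posDef_observerM hroot)))
    (eigMin_pos hN (posDef_observerC hroot))).trans_le hβ

/-- Lyapunov inequality for the observer. -/
theorem exists_observer_lyapunov (hN : 0 < N) (hroot : ∀ i, Relation.ReflTransGen S.Adj 0 i) :
    ∃ δ : ℝ, 0 < δ ∧ ∀ x : Fin N → ℝ, δ * ∑ i, observerWeight S i * x i ^ 2 ≤
      2 * ∑ i, observerWeight S i * (x i * ∑ j, reducedLaplacian S i j * x j) := by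
  have hs : 0 < ∑ i, observerWeight S i :=
    Finset.sum_pos (fun i _ => observerWeight_pos hroot i) ⟨⟨0, hN⟩, Finset.mem_univ _⟩
  refine ⟨(∑ i, observerWeight S i)⁻¹, inv_pos.2 hs, fun x =>
    le_trans ?_ (sum_sq_le_observerC hroot x)⟩
  rw [inv_mul_le_iff₀ hs, Finset.mul_sum]
  refine Finset.sum_le_sum fun i _ => mul_le_mul_of_nonneg_right ?_ (sq_nonneg _)
  exact Finset.single_le_sum (fun j _ => (observerWeight_pos hroot j).le) (Finset.mem_univ i)

end Sensing

namespace Engagement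

variable {N : ℕ} {E : Engagement N} {X : History N} {tgod : ℝ → ℝ} {T : ℝ}

/-! ### The consensus term does not depend on the desired time-to-go -/

theorem consensusTerm_eq (E : Engagement N) (X : History N) (tgod : ℝ → ℝ) (i : Fin N) (t : ℝ) :
    E.consensusTerm X tgod i t = (-E.ζ + E.η * (scalingDot t E.te / scaling t E.te)) *
      ∑ j, digraphLaplacian E.A i j * E.timeToGo X j t := by
  have h1 := sum_weightLaplacian_mul (digraphAdj E.A) (fun j => E.err X tgod j t) i
  have h2 := sum_weightLaplacian_mul (digraphAdj E.A) (fun j => E.timeToGo X j t) i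
  rw [consensusTerm, digraphLaplacian, h1, h2]
  simp only [err, sub_sub_sub_cancel_right]

theorem command_desired_congr (E : Engagement N) (X : History N) (τ τ' : ℝ → ℝ) (i : Fin N)
    (t : ℝ) : E.command X τ i t = E.command X τ' i t := by
  simp only [command, consensusTerm_eq]

theorem IsClosedLoop.change_desired (h : E.IsClosedLoop X tgod T) (τ : ℝ → ℝ) :
    E.IsClosedLoop X τ T :=
  { h with
    γ_deriv := fun i t ht => by
      rw [command_desired_congr E X τ tgod]
      exact h.γ_deriv i t ht }

/-! ### Bounds for the time-to-go -/

theorem k_pos (hnav : ∀ i, 2 < E.nav i) (i : Fin N) : 6 < E.k i := by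
  have := hnav i
  unfold k
  linarith

theorem IsClosedLoop.range_le (h : E.IsClosedLoop X tgod T) (hV : ∀ i, 0 < E.V i) (i : Fin N)
    {t : ℝ} (ht : t ∈ Ico 0 T) : X.r i t ≤ X.r i 0 + E.V i * t := by
  have hsub : Icc 0 t ⊆ Ico 0 T := fun u hu => ⟨hu.1, hu.2.trans_lt ht.2⟩
  have := le_of_hasDerivAt_nonpos_off_finset (f := fun t => X.r i t - E.V i * t)
    (f' := fun t => -(E.V i * cos (X.γ i t - X.θ i t)) - E.V i) {E.tp, E.te} ht.1
    (((h.r_cont i).mono hsub).sub (by fun_prop)) fun u hu hus => by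
      refine ⟨(h.r_deriv i u ⟨⟨hu.1, hu.2.trans ht.2⟩, by simpa using hus⟩).sub
        (by simpa using (hasDerivAt_id u).const_mul (E.V i)), ?_⟩
      have := mul_nonneg (hV i).le (by linarith [neg_one_le_cos (X.γ i u - X.θ i u)] :
        0 ≤ cos (X.γ i u - X.θ i u) + 1)
      linarith
  simp only [mul_zero, sub_zero] at this
  linarith

theorem IsClosedLoop.timeToGo_pos (h : E.IsClosedLoop X tgod T) (hV : ∀ i, 0 < E.V i)
    (hnav : ∀ i, 2 < E.nav i) (i : Fin N) {t : ℝ} (ht : t ∈ Ico 0 T) : 0 < E.timeToGo X i t := by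
  have hk : 0 < E.k i := by linarith [k_pos hnav i]
  have := h.r_pos i t ht
  have := hV i
  unfold timeToGo
  positivity

/-- Bound for the time-to-go up to the time `te` in terms of the initial ranges. -/
noncomputable def timeToGoBound (E : Engagement N) (R : ℝ) : ℝ :=
  ∑ i, (|R| + E.V i * E.te) / E.V i * 2

theorem IsClosedLoop.timeToGo_le (h : E.IsClosedLoop X tgod T) (hV : ∀ i, 0 < E.V i)
    (hnav : ∀ i, 2 < E.nav i) (hte : 0 < E.te) {R : ℝ} (hR : ∀ i, X.r i 0 ≤ R) (i : Fin N) {t : ℝ}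
    (ht : t ∈ Ico 0 T) (hte' : t ≤ E.te) : E.timeToGo X i t ≤ E.timeToGoBound R := by
  have hk : 6 < E.k i := k_pos hnav i
  have hVi := hV i
  have h1 : X.r i t ≤ |R| + E.V i * E.te := by
    have := h.range_le hV i ht
    have := mul_le_mul_of_nonneg_left hte' hVi.le
    linarith [hR i, le_abs_self R]
  have h2 : 1 + sin (leadAngle X i t) ^ 2 / E.k i ≤ 2 := by
    have : sin (leadAngle X i t) ^ 2 / E.k i ≤ 1 := by
      rw [div_le_one (by linarith)]
      linarith [sin_sq_le_one (leadAngle X i t)]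
    linarith
  have h3 : E.timeToGo X i t ≤ (|R| + E.V i * E.te) / E.V i * 2 := by
    have hr := (h.r_pos i t ht).le
    have hk0 : 0 < E.k i := by linarith
    exact mul_le_mul (div_le_div_of_nonneg_right h1 hVi.le) h2 (by positivity) (by positivity)
  exact h3.trans (Finset.single_le_sum (f := fun i => (|R| + E.V i * E.te) / E.V i * 2)
    (fun j _ => by have := hV j; positivity) (Finset.mem_univ i))

/-! ### Convergence of the observer -/

theorem relErr_re (E : Engagement N) (X : History N) (i : Fin N) (t : ℝ) :
    (E.relErr X i t).re = ∑ j, reducedLaplacian E.S i j * (X.est j t - E.target).re := by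
  rw [sum_reducedLaplacian_mul, relErr]
  simp

theorem relErr_im (E : Engagement N) (X : History N) (i : Fin N) (t : ℝ) :
    (E.relErr X i t).im = ∑ j, reducedLaplacian E.S i j * (X.est j t - E.target).im := by
  rw [sum_reducedLaplacian_mul, relErr]
  simp

theorem IsClosedLoop.est_eq (h : E.IsClosedLoop X tgod T)
    (hroot : ∀ i, Relation.ReflTransGen E.S.Adj 0 i) (hα : 0 < E.α) (hβ : 0 < E.β)
    (htp : 0 < E.tp) (hT : E.tp ≤ T) (i : Fin N) {t : ℝ} (ht : t ∈ Ico E.tp T) :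
    X.est i t = E.target := by
  obtain ⟨δ, hδ, hlyap⟩ := exists_observer_lyapunov i.pos hroot
  have hder : ∀ i, ∀ t ∈ Ioo 0 T, t ∉ ({E.tp, E.te} : Finset ℝ) →
      HasDerivAt (fun t => X.est i t - E.target)
        (-(((E.α - E.β * (scalingDot t E.tp / scaling t E.tp) : ℝ) : ℂ) * E.relErr X i t)) t :=
    fun i t ht hts => (h.est_deriv i t ⟨ht, by simpa using hts⟩).sub_const _
  have hcont : ∀ i, ContinuousOn (fun t => X.est i t - E.target) (Ico 0 T) :=
    fun i => (h.est_cont i).sub continuousOn_const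
  have hre := vanish_of_scaled_flow (observerWeight_pos hroot)
    (x := fun i t => (X.est i t - E.target).re) (y := fun i t => (E.relErr X i t).re)
    hα hβ hδ htp htp hT {E.tp, E.te}
    (fun i => Complex.continuous_re.comp_continuousOn (hcont i))
    (fun i t ht hts => by
      have := Complex.reCLM.hasFDerivAt.comp_hasDerivAt t (hder i t ht hts)
      simp only [Complex.reCLM_apply, Complex.neg_re, Complex.re_ofReal_mul] at this
      exact this)
    (fun t _ => by simpa only [relErr_re] using hlyap fun i => (X.est i t - E.target).re)
  have him := vanish_of_scaled_flow (observerWeight_pos hroot)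
    (x := fun i t => (X.est i t - E.target).im) (y := fun i t => (E.relErr X i t).im)
    hα hβ hδ htp htp hT {E.tp, E.te}
    (fun i => Complex.continuous_im.comp_continuousOn (hcont i))
    (fun i t ht hts => by
      have := Complex.imCLM.hasFDerivAt.comp_hasDerivAt t (hder i t ht hts)
      simp only [Complex.imCLM_apply, Complex.neg_im, Complex.im_ofReal_mul] at this
      exact this)
    (fun t _ => by simpa only [relErr_im] using hlyap fun i => (X.est i t - E.target).im)
  exact sub_eq_zero.1 (Complex.ext (hre.2 i t ht) (him.2 i t ht))

theorem relErr_eq_zero {i : Fin N} {t : ℝ} (h : ∀ i, X.est i t = E.target) :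
    E.relErr X i t = 0 := by
  simp [relErr, h]

/-! ### The closed loop with exact estimates -/

theorem exp_mul_I_re_im (r θ : ℝ) :
    ((r : ℂ) * Complex.exp (θ * Complex.I)).re = r * cos θ ∧
      ((r : ℂ) * Complex.exp (θ * Complex.I)).im = r * sin θ := by
  rw [Complex.re_ofReal_mul, Complex.im_ofReal_mul, Complex.exp_ofReal_mul_I_re,
    Complex.exp_ofReal_mul_I_im]
  exact ⟨rfl, rfl⟩

section Exact

variable {i : Fin N} {t : ℝ}

theorem rHat_eq (h : X.est i t = E.target) (hr : 0 < X.r i t) : E.rHat X i t = X.r i t := by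
  rw [rHat, position, h, sub_sub_cancel, norm_mul, Complex.norm_exp_ofReal_mul_I, mul_one,
    Complex.norm_real, norm_of_nonneg hr.le]

theorem trig_θHat (h : X.est i t = E.target) (hr : 0 < X.r i t) :
    cos (E.θHat X i t) = cos (X.θ i t) ∧ sin (E.θHat X i t) = sin (X.θ i t) := by
  have hn := rHat_eq h hr
  rw [rHat] at hn
  have hne : X.est i t - E.position X i t ≠ 0 := norm_pos_iff.1 (hn ▸ hr)
  rw [θHat, Complex.cos_arg hne, Complex.sin_arg, hn, position, h, sub_sub_cancel]
  obtain ⟨h1, h2⟩ := exp_mul_I_re_im (X.r i t) (X.θ i t)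
  rw [h1, h2, mul_div_cancel_left₀ _ hr.ne', mul_div_cancel_left₀ _ hr.ne']
  exact ⟨rfl, rfl⟩

theorem cos_σHat (h : X.est i t = E.target) (hr : 0 < X.r i t) :
    cos (E.σHat X i t) = cos (leadAngle X i t) := by
  rw [σHat, leadAngle, cos_sub, cos_sub, (trig_θHat h hr).1, (trig_θHat h hr).2]

theorem sin_σHat (h : X.est i t = E.target) (hr : 0 < X.r i t) :
    sin (E.σHat X i t) = sin (leadAngle X i t) := by
  rw [σHat, leadAngle, sin_sub, sin_sub, (trig_θHat h hr).1, (trig_θHat h hr).2]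

theorem command_eq (h : X.est i t = E.target) (hr : 0 < X.r i t) (hV : 0 < E.V i) :
    E.command X tgod i t / E.V i = -(E.V i * sin (leadAngle X i t)) / X.r i t
      + (E.V i * E.k i * (cos (leadAngle X i t) - 1 + E.consensusTerm X tgod i t) /
          (X.r i t * (2 * sin (leadAngle X i t) * cos (leadAngle X i t)))
        + E.V i * sin (leadAngle X i t) / (2 * X.r i t)) := by
  rw [command, θHatDot, sin_two_mul, cos_σHat h hr, sin_σHat h hr, rHat_eq h hr]
  have hV' := hV.ne'
  simp only [add_div, mul_div_assoc]
  have e1 : ∀ z, E.V i ^ 2 * z / E.V i = E.V i * z := fun z => by field_simp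
  field_simp
  ring

end Exact

theorem IsClosedLoop.sin_cos_ne (h : E.IsClosedLoop X tgod T) {i : Fin N} {t : ℝ}
    (ht : t ∈ Ico 0 T) (hest : X.est i t = E.target) :
    sin (leadAngle X i t) ≠ 0 ∧ cos (leadAngle X i t) ≠ 0 := by
  have := h.sin_ne i t ht
  rw [sin_two_mul, cos_σHat hest (h.r_pos i t ht), sin_σHat hest (h.r_pos i t ht)] at this
  exact ⟨fun h0 => this (by simp [h0]), fun h0 => this (by simp [h0])⟩

theorem IsClosedLoop.hasDerivAt_leadAngle (h : E.IsClosedLoop X tgod T) (hV : ∀ i, 0 < E.V i)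
    {i : Fin N} {t : ℝ} (ht : t ∈ Ioo 0 T \ {E.tp, E.te}) (hest : X.est i t = E.target) :
    HasDerivAt (leadAngle X i)
      (E.V i * E.k i * (cos (leadAngle X i t) - 1 + E.consensusTerm X tgod i t) /
          (X.r i t * (2 * sin (leadAngle X i t) * cos (leadAngle X i t)))
        + E.V i * sin (leadAngle X i t) / (2 * X.r i t)) t := by
  have h1 := (h.γ_deriv i t ht).sub (h.θ_deriv i t ht)
  rw [command_eq hest (h.r_pos i t (Ioo_subset_Ico_self ht.1)) (hV i)] at h1
  simp only [leadAngle] at h1 ⊢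
  convert! h1 using 1
  ring

theorem IsClosedLoop.hasDerivAt_timeToGo (h : E.IsClosedLoop X tgod T) (hV : ∀ i, 0 < E.V i)
    (hnav : ∀ i, 2 < E.nav i) {i : Fin N} {t : ℝ} (ht : t ∈ Ioo 0 T \ {E.tp, E.te})
    (hest : X.est i t = E.target) :
    HasDerivAt (E.timeToGo X i) (-1 + E.consensusTerm X tgod i t) t := by
  have ht0 := Ioo_subset_Ico_self ht.1
  obtain ⟨hs, hc⟩ := h.sin_cos_ne ht0 hest
  have hr := (h.r_pos i t ht0).ne'
  have hk : E.k i ≠ 0 := by linarith [k_pos hnav i]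
  have hVi := (hV i).ne'
  have h1 := ((h.r_deriv i t ht).div_const (E.V i)).mul
    ((((h.hasDerivAt_leadAngle hV ht hest).sin.pow 2).div_const (E.k i)).const_add 1)
  refine h1.congr_deriv ?_
  have e : X.γ i t - X.θ i t = leadAngle X i t := rfl
  rw [e, Pi.pow_apply]
  generalize E.consensusTerm X tgod i t = u
  generalize sin (leadAngle X i t) = s at *
  generalize cos (leadAngle X i t) = c at *
  generalize X.r i t = r at *
  field_simp
  push_cast
  ring

theorem IsClosedLoop.continuousOn_timeToGo (h : E.IsClosedLoop X tgod T) (i : Fin N) :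
    ContinuousOn (E.timeToGo X i) (Ico 0 T) :=
  ((h.r_cont i).div_const _).mul (continuousOn_const.add
    (((continuous_sin.comp_continuousOn ((h.γ_cont i).sub (h.θ_cont i))).pow 2).div_const _))

/-- Consensus of the time-to-go within the predefined time, for a trajectory whose observers have
converged at the time `tp`. -/
theorem IsClosedLoop.exists_final_time (h : E.IsClosedLoop X tgod T) (hN : 0 < N)
    (hV : ∀ i, 0 < E.V i) (hnav : ∀ i, 2 < E.nav i) (hA : StronglyConnected E.A)
    (hζ : 0 < E.ζ) (hη : 0 < E.η) (htp : 0 < E.tp) (hte : E.tp < E.te) (hT : E.te ≤ T)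
    (hest : ∀ i, ∀ t ∈ Ico E.tp T, X.est i t = E.target) {B : ℝ}
    (hB : ∀ i, ∀ t ∈ Ico 0 T, t ≤ E.te → E.timeToGo X i t ≤ B) :
    ∃ Tf : ℝ, T ≤ Tf ∧
      (∀ i, ∀ t ∈ Ico 0 T, |E.err X (fun t => Tf - t) i t| ≤ B + E.te) ∧
      (∀ i, Tendsto (E.err X (fun t => Tf - t) i) (𝓝[<] E.te) (𝓝 0)) ∧
      (∀ i, ∀ t ∈ Ico E.te T, E.err X (fun t => Tf - t) i t = 0) := by
  have : Nonempty (Fin N) := ⟨⟨0, hN⟩⟩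
  have hte0 : 0 < E.te := htp.trans hte
  obtain ⟨ν, δ, hν, hν1, hδ, hν0, hlyap⟩ := exists_consensus_lyapunov hA
  have hsub : Ico E.tp T ⊆ Ico 0 T := Ico_subset_Ico_left htp.le
  set m : ℝ → ℝ := fun t => ∑ i, ν i * E.timeToGo X i t + t with hm
  have hder : ∀ i, ∀ t ∈ Ioo E.tp T, t ∉ ({E.te} : Finset ℝ) →
      HasDerivAt (E.timeToGo X i) (-1 + E.consensusTerm X tgod i t) t := fun i t ht hts =>
    h.hasDerivAt_timeToGo hV hnav ⟨⟨htp.trans ht.1, ht.2⟩, by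
      simpa [ht.1.ne'] using hts⟩ (hest i t (Ioo_subset_Ico_self ht))
  have hmder : ∀ t ∈ Ioo E.tp T, t ∉ ({E.te} : Finset ℝ) → HasDerivAt m 0 t := by
    intro t ht hts
    have h1 : HasDerivAt m (∑ i, ν i * (-1 + E.consensusTerm X tgod i t) + 1) t :=
      (HasDerivAt.fun_sum fun i _ => (hder i t ht hts).const_mul (ν i)).add (hasDerivAt_id t)
    convert! h1 using 1
    have h2 : ∑ i, ν i * E.consensusTerm X tgod i t = 0 := by
      simp only [consensusTerm_eq, mul_left_comm (ν _), ← Finset.mul_sum, hν0, mul_zero]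
    simp only [mul_add, Finset.sum_add_distrib, h2, mul_neg, mul_one, Finset.sum_neg_distrib, hν1]
    norm_num
  have hmcont : ContinuousOn m (Ico 0 T) := (continuousOn_finsetSum _ fun i _ =>
    continuousOn_const.mul (h.continuousOn_timeToGo i)).add continuousOn_id
  have hmconst : ∀ t ∈ Ico E.tp T, m t = m E.tp := fun t ht =>
    eq_of_hasDerivAt_zero_off_finset {E.te} ht.1
      (hmcont.mono fun u hu => hsub ⟨hu.1, hu.2.trans_lt ht.2⟩)
      fun u hu hus => hmder u ⟨hu.1, hu.2.trans ht.2⟩ hus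
  set Tf := m E.tp with hTf
  have herr0 : ∀ t ∈ Ico E.tp T, ∑ i, ν i * E.err X (fun t => Tf - t) i t = 0 := by
    intro t ht
    have h1 := hmconst t ht
    simp only [hm] at h1
    simp only [err, mul_sub, Finset.sum_sub_distrib, ← Finset.sum_mul, hν1]
    linarith
  have hmain := vanish_of_scaled_flow hν (x := E.err X (fun t => Tf - t))
    (y := fun i t => ∑ j, digraphLaplacian E.A i j * E.err X (fun t => Tf - t) j t)
    hζ hη hδ hte0 hte hT {E.te}
    (fun i => ((h.continuousOn_timeToGo i).mono hsub).sub (by fun_prop))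
    (fun i t ht hts => by
      have h1 := (hder i t ht hts).sub ((hasDerivAt_id t).const_sub Tf)
      refine h1.congr_deriv ?_
      rw [consensusTerm_eq, ← consensusTerm_eq E X (fun t => Tf - t), consensusTerm]
      ring)
    (fun t ht => hlyap _ (herr0 t (Ioo_subset_Ico_self ht)))
  have hpos := fun i t ht => (h.timeToGo_pos hV hnav (i := i) (t := t) ht)
  have htpT : E.tp ∈ Ico 0 T := ⟨htp.le, hte.trans_le hT⟩
  have hTfB : E.tp ≤ Tf ∧ Tf ≤ B + E.tp := by
    have h1 : ∑ i, ν i * E.timeToGo X i E.tp ≤ ∑ i, ν i * B :=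
      Finset.sum_le_sum fun i _ => mul_le_mul_of_nonneg_left (hB i _ htpT hte.le) (hν i).le
    have h2 : 0 ≤ ∑ i, ν i * E.timeToGo X i E.tp :=
      Finset.sum_nonneg fun i _ => mul_nonneg (hν i).le (hpos i _ htpT).le
    rw [← Finset.sum_mul, hν1, one_mul] at h1
    simp only [hTf, hm]
    constructor <;> linarith
  have i₀ : Fin N := ⟨0, hN⟩
  refine ⟨Tf, ?_, fun i t ht => ?_, hmain.1, hmain.2⟩
  · rcases hT.eq_or_lt with hT' | hT'
    · refine hT' ▸ ?_
      have h1 : Tendsto (fun t => E.err X (fun t => Tf - t) i₀ t + (Tf - t)) (𝓝[<] E.te)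
          (𝓝 (0 + (Tf - E.te))) := (hmain.1 i₀).add
        ((Continuous.tendsto (by fun_prop) _).mono_left nhdsWithin_le_nhds)
      have h2 := ge_of_tendsto h1 (b := 0) (by
        filter_upwards [Ioo_mem_nhdsLT hte0] with t ht
        have := hpos i₀ t ⟨ht.1.le, hT' ▸ ht.2⟩
        simp only [err]
        linarith)
      linarith
    · refine le_of_forall_lt fun t ht => ?_
      have hmem : max t E.te ∈ Ico E.te T := ⟨le_max_right _ _, max_lt ht hT'⟩
      have h1 := hmain.2 i₀ _ hmem
      have h2 := hpos i₀ _ ⟨hte0.le.trans hmem.1, hmem.2⟩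
      simp only [err] at h1
      have := le_max_left t E.te
      linarith
  · have hB0 : 0 ≤ B := (hpos i₀ _ htpT).le.trans (hB i₀ _ htpT hte.le)
    rcases lt_or_ge t E.te with htt | htt
    · have h1 := hpos i t ht
      have h2 := hB i t ht htt.le
      have h3 := ht.1
      simp only [err]
      rw [abs_le]
      constructor <;> linarith [hTfB.1, hTfB.2]
    · rw [hmain.2 i t ⟨htt, ht.2⟩, abs_zero]
      linarith

end Engagement

/-! ### The terminal phase of a single interceptor -/

/-- The rate of the lead angle with respect to `-log (Tf - t)` in the terminal phase, with the cosine
of the lead angle cut off at `c₀`. -/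
noncomputable def leadField (k c₀ x : ℝ) : ℝ :=
  (1 + sin x * sin x * k⁻¹) * 2⁻¹ *
    (sin x * (1 - k * ((1 + max (cos x) c₀) * max (cos x) c₀)⁻¹))

theorem boundedLipschitz_leadField (k : ℝ) {c₀ : ℝ} (hc₀ : 0 < c₀) :
    BoundedLipschitz (leadField k c₀) := by
  have hm := BoundedLipschitz.cos.max_const c₀
  have hle : ∀ x, c₀ ≤ max (cos x) c₀ := fun x => le_max_right _ _
  refine (((BoundedLipschitz.const 1).add ((BoundedLipschitz.sin.mul BoundedLipschitz.sin).mul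
    (.const k⁻¹))).mul (.const 2⁻¹)).mul (BoundedLipschitz.sin.mul ((BoundedLipschitz.const 1).sub
      ((BoundedLipschitz.const k).mul ((((BoundedLipschitz.const 1).add hm).mul hm).inv hc₀ ?_))))
  intro x
  have h1 := hle x
  nlinarith [hc₀.trans_le h1]

theorem one_sub_gain_ratio_nonpos {k c : ℝ} (hk : 6 < k) (hc : 0 < c) (hc1 : c ≤ 1) :
    1 - k * ((1 + c) * c)⁻¹ ≤ 0 := by
  have h1 : (1 + c) * c ≤ k := by nlinarith
  have h2 : 0 < (1 + c) * c := by positivity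
  rw [sub_nonpos, ← div_eq_mul_inv, le_div_iff₀ h2]
  linarith

/-- `(σ, θ, r)` are the lead angle, the line-of-sight angle and the range on `[t₁, T)` of an
interceptor whose time-to-go is exactly `Tf - t` and whose command has no consensus term. -/
structure IsTerminalCourse (V k Tf t₁ T : ℝ) (σ θ r : ℝ → ℝ) : Prop where
  r_pos : ∀ t ∈ Ico t₁ T, 0 < r t
  timeToGo : ∀ t ∈ Ico t₁ T, r t / V * (1 + sin (σ t) ^ 2 / k) = Tf - t
  cos_pos : ∀ t ∈ Ico t₁ T, 0 < cos (σ t)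
  sin_ne : ∀ t ∈ Ico t₁ T, sin (σ t) ≠ 0
  r_deriv : ∀ t ∈ Ico t₁ T, HasDerivAt r (-(V * cos (σ t))) t
  θ_deriv : ∀ t ∈ Ico t₁ T, HasDerivAt θ (-(V * sin (σ t)) / r t) t
  σ_deriv : ∀ t ∈ Ico t₁ T, HasDerivAt σ
    (V / (2 * r t) * (sin (σ t) * (1 - k * ((1 + cos (σ t)) * cos (σ t))⁻¹))) t

namespace IsTerminalCourse

variable {V k Tf t₁ T : ℝ} {σ θ r σ' θ' r' : ℝ → ℝ}

theorem mono {T' : ℝ} (h : IsTerminalCourse V k Tf t₁ T σ θ r) (hT : T' ≤ T) :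
    IsTerminalCourse V k Tf t₁ T' σ θ r :=
  have hsub : ∀ t ∈ Ico t₁ T', t ∈ Ico t₁ T := fun _ ht => ⟨ht.1, ht.2.trans_le hT⟩
  { r_pos := fun t ht => h.r_pos t (hsub t ht)
    timeToGo := fun t ht => h.timeToGo t (hsub t ht)
    cos_pos := fun t ht => h.cos_pos t (hsub t ht)
    sin_ne := fun t ht => h.sin_ne t (hsub t ht)
    r_deriv := fun t ht => h.r_deriv t (hsub t ht)
    θ_deriv := fun t ht => h.θ_deriv t (hsub t ht)
    σ_deriv := fun t ht => h.σ_deriv t (hsub t ht) }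

theorem cos_le (h : IsTerminalCourse V k Tf t₁ T σ θ r) (hV : 0 < V) (hk : 6 < k) {t : ℝ}
    (ht : t ∈ Ico t₁ T) : cos (σ t₁) ≤ cos (σ t) := by
  have hsub : ∀ u ∈ Icc t₁ t, u ∈ Ico t₁ T := fun u hu => ⟨hu.1, hu.2.trans_lt ht.2⟩
  have := le_of_hasDerivAt_nonpos_off_finset ∅ ht.1 (f := fun t => -cos (σ t))
    (fun u hu => (h.σ_deriv u (hsub u hu)).cos.neg.continuousAt.continuousWithinAt)
    fun u hu _ => by
      have hu' := hsub u (Ioo_subset_Icc_self hu)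
      refine ⟨(h.σ_deriv u hu').cos.fun_neg, ?_⟩
      have h1 := one_sub_gain_ratio_nonpos hk (h.cos_pos u hu') (cos_le_one _)
      have h2 : 0 ≤ V / (2 * r u) := by have := h.r_pos u hu'; positivity
      have h3 := mul_nonneg h2 (mul_nonneg (mul_self_nonneg (sin (σ u))) (neg_nonneg.2 h1))
      linarith
  linarith

theorem σ_deriv_eq (h : IsTerminalCourse V k Tf t₁ T σ θ r) (hV : 0 < V) (hk : 6 < k) {t : ℝ}
    (ht : t ∈ Ico t₁ T) : HasDerivAt σ (leadField k (cos (σ t₁)) (σ t) / (Tf - t)) t := by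
  refine (h.σ_deriv t ht).congr_deriv ?_
  rw [← h.timeToGo t ht, leadField, max_eq_left (h.cos_le hV hk ht)]
  have h1 := (h.r_pos t ht).ne'
  have h2 : 1 + sin (σ t) ^ 2 / k ≠ 0 := by positivity
  have h3 : 1 + sin (σ t) * sin (σ t) * k⁻¹ = 1 + sin (σ t) ^ 2 / k := by
    rw [div_eq_mul_inv, sq]
  rw [h3]
  generalize 1 + sin (σ t) ^ 2 / k = D at *
  field_simp

theorem eq (h : IsTerminalCourse V k Tf t₁ T σ θ r) (h' : IsTerminalCourse V k Tf t₁ T σ' θ' r')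
    (hV : 0 < V) (hk : 6 < k) (hTf : T ≤ Tf) (hσ : σ t₁ = σ' t₁) (hθ : θ t₁ = θ' t₁) {t : ℝ}
    (ht : t ∈ Ico t₁ T) : σ t = σ' t ∧ θ t = θ' t ∧ r t = r' t := by
  have hsub : ∀ u ∈ Icc t₁ t, u ∈ Ico t₁ T := fun u hu => ⟨hu.1, hu.2.trans_lt ht.2⟩
  have hσe : ∀ u ∈ Icc t₁ t, σ u = σ' u := by
    obtain ⟨M, hM⟩ := (boundedLipschitz_leadField k
      (h.cos_pos t₁ (hsub t₁ (left_mem_Icc.2 ht.1)))).lipschitzWith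
    have hb : 0 < Tf - t := by linarith [ht.2]
    refine ODE_solution_unique_of_mem_Icc_right
      (v := fun u x => leadField k (cos (σ t₁)) x / (Tf - u)) (s := fun _ => univ)
      (K := ⟨M / (Tf - t), by positivity⟩) (fun u hu => ?_)
      (fun u hu => (h.σ_deriv u (hsub u hu)).continuousAt.continuousWithinAt)
      (fun u hu => (h.σ_deriv_eq hV hk (hsub u (Ico_subset_Icc_self hu))).hasDerivWithinAt)
      (fun _ _ => trivial)
      (fun u hu => (h'.σ_deriv u (hsub u hu)).continuousAt.continuousWithinAt)
      (fun u hu => ?_) (fun _ _ => trivial) hσ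
    · refine LipschitzOnWith.of_dist_le_mul fun x _ y _ => ?_
      have hu' : 0 < Tf - u := by linarith [hu.2]
      have h1 := hM.dist_le_mul x y
      rw [Real.dist_eq] at h1 ⊢
      rw [← sub_div, abs_div, abs_of_pos hu']
      refine (div_le_div₀ (by positivity) h1 hb (by linarith [hu.2])).trans (le_of_eq ?_)
      show _ = M / (Tf - t) * _
      ring
    · rw [hσ]
      exact (h'.σ_deriv_eq hV hk (hsub u (Ico_subset_Icc_self hu))).hasDerivWithinAt
  have hre : ∀ u ∈ Icc t₁ t, r u = r' u := by
    intro u hu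
    have h1 := h.timeToGo u (hsub u hu)
    rw [← h'.timeToGo u (hsub u hu), hσe u hu] at h1
    have h2 : 1 + sin (σ' u) ^ 2 / k ≠ 0 := by positivity
    have h3 := mul_right_cancel₀ h2 h1
    field_simp at h3
    exact h3
  have htt := right_mem_Icc.2 ht.1
  refine ⟨hσe t htt, ?_, hre t htt⟩
  have := eq_of_hasDerivAt_zero_off_finset ∅ ht.1 (f := fun t => θ t - θ' t)
    (fun u hu => ((h.θ_deriv u (hsub u hu)).sub
      (h'.θ_deriv u (hsub u hu))).continuousAt.continuousWithinAt)
    fun u hu _ => by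
      have hu' := Ioo_subset_Icc_self hu
      have h1 := (h.θ_deriv u (hsub u hu')).sub (h'.θ_deriv u (hsub u hu'))
      rw [hσe u hu', hre u hu', sub_self] at h1
      exact h1
  linarith

end IsTerminalCourse

theorem terminal_range_identity {V w k s c : ℝ} (hV : V ≠ 0) (hw : w ≠ 0) (hk : k ≠ 0) (hc : 0 < c)
    (hD : 1 + s ^ 2 / k ≠ 0) (hsc : s ^ 2 + c ^ 2 = 1) :
    (V * -1 * (1 + s ^ 2 / k) - V * w * (((2 : ℕ) : ℝ) * s ^ (2 - 1) * (c *
      (V / (2 * (V * w / (1 + s ^ 2 / k))) * (s * (1 - k * ((1 + c) * c)⁻¹)))) / k)) /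
        (1 + s ^ 2 / k) ^ 2 = -(V * c) := by
  have h1 : 1 + c ≠ 0 := by positivity
  have h2 : c * (s * (s * (1 - k * ((1 + c) * c)⁻¹))) / k = c * (1 + s ^ 2 / k) - 1 := by
    field_simp
    linear_combination (-k) * hsc
  have h3 : V / (2 * (V * w / (1 + s ^ 2 / k))) = (1 + s ^ 2 / k) / (2 * w) := by field_simp
  rw [h3]
  generalize 1 + s ^ 2 / k = D at *
  generalize 1 - k * ((1 + c) * c)⁻¹ = G at *
  have h4 : V * w * (((2 : ℕ) : ℝ) * s ^ (2 - 1) * (c * (D / (2 * w) * (s * G))) / k) =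
      V * D * (c * (s * (s * G)) / k) := by
    push_cast
    field_simp
  rw [h4, h2]
  field_simp
  ring

theorem exists_isTerminalCourse {V k Tf t₁ σ₁ : ℝ} (hV : 0 < V) (hk : 6 < k)
    (hc : 0 < cos σ₁) (hs : sin σ₁ ≠ 0) (θ₁ : ℝ) :
    ∃ σ θ r : ℝ → ℝ, σ t₁ = σ₁ ∧ θ t₁ = θ₁ ∧ IsTerminalCourse V k Tf t₁ Tf σ θ r := by
  set c₀ := cos σ₁
  set τ : ℝ → ℝ := fun t => -log (Tf - t) with hτ
  have hτd : ∀ t, t < Tf → HasDerivAt τ (1 / (Tf - t)) t := fun t ht => by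
    have h1 := (((hasDerivAt_id t).const_sub Tf).log (sub_pos.2 ht).ne').fun_neg
    refine h1.congr_deriv ?_
    simp only [id_eq]
    rw [neg_div, neg_neg]
  have hbl := boundedLipschitz_leadField k hc
  obtain ⟨A, hA0, hA⟩ := hbl.exists_global_solution (τ t₁) σ₁
  have hsin : ∀ s, sin (A s) ≠ 0 := by
    intro s h0
    obtain ⟨M, hM⟩ := hbl.lipschitzWith
    have : A = fun _ => A s := ODE_solution_unique_univ (v := fun _ => leadField k c₀)
      (s := fun _ => univ) (t₀ := s) (fun _ => hM.lipschitzOnWith) (fun t => ⟨hA t, trivial⟩)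
      (fun t => ⟨by simpa [leadField, h0] using hasDerivAt_const t (A s), trivial⟩) rfl
    have h1 := congrFun this (τ t₁)
    rw [hA0] at h1
    exact hs (h1 ▸ h0)
  have hm : ∀ x, 0 < max (cos x) c₀ ∧ max (cos x) c₀ ≤ 1 := fun x =>
    ⟨hc.trans_le (le_max_right _ _), max_le (cos_le_one _) (cos_le_one _)⟩
  have hcos : ∀ s, τ t₁ ≤ s → c₀ ≤ cos (A s) := by
    intro s hs
    have := le_of_hasDerivAt_nonpos_off_finset ∅ hs (f := fun t => -cos (A t))
      (fun u _ => (hA u).cos.neg.continuousAt.continuousWithinAt)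
      fun u _ _ => by
        refine ⟨(hA u).cos.fun_neg, ?_⟩
        have h1 := one_sub_gain_ratio_nonpos hk (hm (A u)).1 (hm (A u)).2
        have h2 : 0 ≤ (1 + sin (A u) * sin (A u) * k⁻¹) * 2⁻¹ := by
          have := mul_self_nonneg (sin (A u))
          positivity
        have h3 := mul_nonneg h2 (mul_nonneg (mul_self_nonneg (sin (A u))) (neg_nonneg.2 h1))
        rw [leadField]
        linarith
    rw [hA0] at this
    linarith
  have hAc : Continuous A := continuous_iff_continuousAt.2 fun s => (hA s).continuousAt
  set g : ℝ → ℝ := fun s => -(sin (A s) * (1 + sin (A s) ^ 2 / k)) with hg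
  have hgc : Continuous g := by fun_prop
  set σ : ℝ → ℝ := fun t => A (τ t) with hσ
  set r : ℝ → ℝ := fun t => V * (Tf - t) / (1 + sin (σ t) ^ 2 / k) with hr
  have hD : ∀ t, 0 < 1 + sin (σ t) ^ 2 / k := fun t => by positivity
  have hτle : ∀ t ∈ Ico t₁ Tf, τ t₁ ≤ τ t := fun t ht => by
    simp only [hτ]
    exact neg_le_neg (log_le_log (sub_pos.2 ht.2) (by linarith [ht.1]))
  have hcosσ : ∀ t ∈ Ico t₁ Tf, c₀ ≤ cos (σ t) := fun t ht => hcos _ (hτle t ht)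
  have hrpos : ∀ t ∈ Ico t₁ Tf, 0 < r t := fun t ht =>
    div_pos (mul_pos hV (sub_pos.2 ht.2)) (hD t)
  have hσd : ∀ t ∈ Ico t₁ Tf, HasDerivAt σ
      (V / (2 * r t) * (sin (σ t) * (1 - k * ((1 + cos (σ t)) * cos (σ t))⁻¹))) t := by
    intro t ht
    refine ((hA (τ t)).comp t (hτd t ht.2)).congr_deriv ?_
    have e : A (τ t) = σ t := rfl
    rw [e, leadField, max_eq_left (hcosσ t ht)]
    have h3 : 1 + sin (σ t) * sin (σ t) * k⁻¹ = 1 + sin (σ t) ^ 2 / k := by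
      rw [div_eq_mul_inv, sq]
    rw [h3]
    simp only [hr]
    have h4 := (hD t).ne'
    have h5 := (sub_pos.2 ht.2).ne'
    generalize 1 + sin (σ t) ^ 2 / k = D at *
    generalize sin (σ t) * (1 - k * ((1 + cos (σ t)) * cos (σ t))⁻¹) = G
    field_simp
  refine ⟨σ, fun t => θ₁ + ∫ s in τ t₁..τ t, g s, r, hA0, by simp, ?_⟩
  exact
    { r_pos := hrpos
      timeToGo := fun t ht => by
        simp only [hr]
        have h4 := (hD t).ne'
        generalize 1 + sin (σ t) ^ 2 / k = D at *
        field_simp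
      cos_pos := fun t ht => hc.trans_le (hcosσ t ht)
      sin_ne := fun t _ => hsin _
      r_deriv := fun t ht => by
        have h1 := (((hasDerivAt_id t).const_sub Tf).const_mul V).div
          ((((hσd t ht).sin.pow 2).div_const k).const_add 1) (hD t).ne'
        refine h1.congr_deriv ?_
        exact terminal_range_identity hV.ne' (sub_pos.2 ht.2).ne' (by linarith)
          (hc.trans_le (hcosσ t ht)) (hD t).ne' (sin_sq_add_cos_sq (σ t))
      θ_deriv := fun t ht => by
        have h1 := ((hgc.integral_hasStrictDerivAt (τ t₁) (τ t)).hasDerivAt.comp t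
          (hτd t ht.2)).const_add θ₁
        refine h1.congr_deriv ?_
        have e : A (τ t) = σ t := rfl
        simp only [hg, hr, e]
        have h4 := (hD t).ne'
        have h5 := (sub_pos.2 ht.2).ne'
        generalize 1 + sin (σ t) ^ 2 / k = D at *
        field_simp
      σ_deriv := hσd }

theorem continuousOn_Ico_glue {α : Type*} [TopologicalSpace α] {f g : ℝ → α} {a T Tf : ℝ}
    (hf : ContinuousOn f (Ico a T)) (hfg : ∀ t < T, g t = f t)
    (hg : ∀ t ∈ Ico T Tf, ContinuousAt g t) : ContinuousOn g (Ico a Tf) := by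
  intro t ht
  rcases lt_or_ge t T with htT | htT
  · have h1 : Ico a T ∈ 𝓝[Ico a Tf] t := by
      filter_upwards [self_mem_nhdsWithin, mem_nhdsWithin_of_mem_nhds (Iio_mem_nhds htT)]
        with u hu hu'
      exact ⟨hu.1, hu'⟩
    refine ((hf t ⟨ht.1, htT⟩).mono_of_mem_nhdsWithin h1).congr_of_eventuallyEq ?_ (hfg t htT)
    exact mem_nhdsWithin_of_mem_nhds (by filter_upwards [Iio_mem_nhds htT] with u hu using hfg u hu)
  · exact (hg t ⟨htT, ht.2⟩).continuousWithinAt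

namespace Engagement

variable {N : ℕ} {E : Engagement N} {X Y : History N} {tgod : ℝ → ℝ} {T : ℝ}

/-- The closed-loop equations and the regularity conditions at a single instant. -/
structure IsRegularAt (E : Engagement N) (X : History N) (tgod : ℝ → ℝ) (t : ℝ) : Prop where
  r_pos : ∀ i, 0 < X.r i t
  rHat_ne : ∀ i, E.rHat X i t ≠ 0
  sin_ne : ∀ i, sin (2 * E.σHat X i t) ≠ 0
  r_deriv : ∀ i, HasDerivAt (X.r i) (-(E.V i * cos (X.γ i t - X.θ i t))) t
  θ_deriv : ∀ i, HasDerivAt (X.θ i) (-(E.V i * sin (X.γ i t - X.θ i t)) / X.r i t) t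
  γ_deriv : ∀ i, HasDerivAt (X.γ i) (E.command X tgod i t / E.V i) t
  est_deriv : ∀ i, HasDerivAt (X.est i)
    (-(((E.α - E.β * (scalingDot t E.tp / scaling t E.tp) : ℝ) : ℂ) * E.relErr X i t)) t

/-- Two histories with the same values at the time `t`. -/
def AgreeAt (X Y : History N) (t : ℝ) : Prop :=
  ∀ i, Y.r i t = X.r i t ∧ Y.θ i t = X.θ i t ∧ Y.γ i t = X.γ i t ∧ Y.est i t = X.est i t

namespace AgreeAt

variable {t : ℝ}

theorem leadAngle (h : AgreeAt X Y t) (i : Fin N) : leadAngle Y i t = leadAngle X i t := by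
  simp only [Engagement.leadAngle, h i]

theorem rHat (h : AgreeAt X Y t) (i : Fin N) : E.rHat Y i t = E.rHat X i t := by
  simp only [Engagement.rHat, position, h i]

theorem σHat (h : AgreeAt X Y t) (i : Fin N) : E.σHat Y i t = E.σHat X i t := by
  simp only [Engagement.σHat, θHat, position, h i]

theorem timeToGo (h : AgreeAt X Y t) (i : Fin N) : E.timeToGo Y i t = E.timeToGo X i t := by
  simp only [Engagement.timeToGo, h.leadAngle, h i]

theorem err (h : AgreeAt X Y t) (i : Fin N) : E.err Y tgod i t = E.err X tgod i t := by
  simp only [Engagement.err, h.timeToGo]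

theorem command (h : AgreeAt X Y t) (i : Fin N) : E.command Y tgod i t = E.command X tgod i t := by
  simp only [Engagement.command, θHatDot, consensusTerm, h.rHat, h.σHat, h.err]

theorem relErr (h : AgreeAt X Y t) (i : Fin N) : E.relErr Y i t = E.relErr X i t := by
  simp only [Engagement.relErr, h _]

end AgreeAt

theorem IsRegularAt.congr {t : ℝ} (h : E.IsRegularAt X tgod t)
    (hXY : ∀ᶠ u in 𝓝 t, AgreeAt X Y u) : E.IsRegularAt Y tgod t := by
  have h0 := hXY.self_of_nhds
  exact
    { r_pos := fun i => by rw [(h0 i).1]; exact h.r_pos i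
      rHat_ne := fun i => by rw [h0.rHat]; exact h.rHat_ne i
      sin_ne := fun i => by rw [h0.σHat]; exact h.sin_ne i
      r_deriv := fun i => by
        rw [(h0 i).2.1, (h0 i).2.2.1]
        exact (h.r_deriv i).congr_of_eventuallyEq (hXY.mono fun u hu => (hu i).1)
      θ_deriv := fun i => by
        rw [(h0 i).1, (h0 i).2.1, (h0 i).2.2.1]
        exact (h.θ_deriv i).congr_of_eventuallyEq (hXY.mono fun u hu => (hu i).2.1)
      γ_deriv := fun i => by
        rw [h0.command]
        exact (h.γ_deriv i).congr_of_eventuallyEq (hXY.mono fun u hu => (hu i).2.2.1)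
      est_deriv := fun i => by
        rw [h0.relErr]
        exact (h.est_deriv i).congr_of_eventuallyEq (hXY.mono fun u hu => (hu i).2.2.2) }

theorem IsClosedLoop.isRegularAt (h : E.IsClosedLoop X tgod T) {t : ℝ}
    (ht : t ∈ Ioo 0 T \ {E.tp, E.te}) : E.IsRegularAt X tgod t :=
  have ht0 := Ioo_subset_Ico_self ht.1
  { r_pos := fun i => h.r_pos i t ht0
    rHat_ne := fun i => h.rHat_ne i t ht0
    sin_ne := fun i => h.sin_ne i t ht0
    r_deriv := fun i => h.r_deriv i t ht
    θ_deriv := fun i => h.θ_deriv i t ht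
    γ_deriv := fun i => h.γ_deriv i t ht
    est_deriv := fun i => h.est_deriv i t ht }

/-- A closed-loop trajectory on `[0, T)` continued by regular instants. -/
theorem IsClosedLoop.extend (h : E.IsClosedLoop X tgod T) {Tf : ℝ} (hXY : ∀ t < T, AgreeAt X Y t)
    (hY : ∀ t ∈ Ico T Tf, E.IsRegularAt Y tgod t) : E.IsClosedLoop Y tgod Tf := by
  have hreg : ∀ t ∈ Ioo 0 Tf \ {E.tp, E.te}, E.IsRegularAt Y tgod t := by
    intro t ht
    rcases lt_or_ge t T with htT | htT
    · exact (h.isRegularAt ⟨⟨ht.1.1, htT⟩, ht.2⟩).congr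
        (by filter_upwards [Iio_mem_nhds htT] with u hu using hXY u hu)
    · exact hY t ⟨htT, ht.1.2⟩
  exact
    { r_pos := fun i t ht => (lt_or_ge t T).elim
        (fun htT => by rw [(hXY t htT i).1]; exact h.r_pos i t ⟨ht.1, htT⟩)
        fun htT => (hY t ⟨htT, ht.2⟩).r_pos i
      rHat_ne := fun i t ht => (lt_or_ge t T).elim
        (fun htT => by rw [(hXY t htT).rHat]; exact h.rHat_ne i t ⟨ht.1, htT⟩)
        fun htT => (hY t ⟨htT, ht.2⟩).rHat_ne i
      sin_ne := fun i t ht => (lt_or_ge t T).elim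
        (fun htT => by rw [(hXY t htT).σHat]; exact h.sin_ne i t ⟨ht.1, htT⟩)
        fun htT => (hY t ⟨htT, ht.2⟩).sin_ne i
      r_cont := fun i => continuousOn_Ico_glue (h.r_cont i) (fun t ht => (hXY t ht i).1)
        fun t ht => ((hY t ht).r_deriv i).continuousAt
      θ_cont := fun i => continuousOn_Ico_glue (h.θ_cont i) (fun t ht => (hXY t ht i).2.1)
        fun t ht => ((hY t ht).θ_deriv i).continuousAt
      γ_cont := fun i => continuousOn_Ico_glue (h.γ_cont i) (fun t ht => (hXY t ht i).2.2.1)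
        fun t ht => ((hY t ht).γ_deriv i).continuousAt
      est_cont := fun i => continuousOn_Ico_glue (h.est_cont i) (fun t ht => (hXY t ht i).2.2.2)
        fun t ht => ((hY t ht).est_deriv i).continuousAt
      r_deriv := fun i t ht => (hreg t ht).r_deriv i
      θ_deriv := fun i t ht => (hreg t ht).θ_deriv i
      γ_deriv := fun i t ht => (hreg t ht).γ_deriv i
      est_deriv := fun i t ht => (hreg t ht).est_deriv i }

/-- An initially acute estimated lead angle stays acute. -/
theorem IsClosedLoop.cos_σHat_pos (h : E.IsClosedLoop X tgod T) {i : Fin N}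
    (h0 : 0 < cos (E.σHat X i 0)) {t : ℝ} (ht : t ∈ Ico 0 T) : 0 < cos (E.σHat X i t) := by
  set z : ℝ → ℂ := fun t => X.est i t - E.position X i t with hz
  have hne : ∀ t ∈ Ico 0 T, z t ≠ 0 := fun t ht => norm_ne_zero_iff.1 (h.rHat_ne i t ht)
  have hzc : ContinuousOn z (Ico 0 T) := by
    refine (h.est_cont i).sub (continuousOn_const.sub
      ((Complex.continuous_ofReal.comp_continuousOn (h.r_cont i)).mul ?_))
    exact Complex.continuous_exp.comp_continuousOn
      ((Complex.continuous_ofReal.comp_continuousOn (h.θ_cont i)).mul continuousOn_const)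
  have heq : EqOn (fun t => cos (E.σHat X i t)) (fun t => cos (X.γ i t) * ((z t).re / ‖z t‖) +
      sin (X.γ i t) * ((z t).im / ‖z t‖)) (Ico 0 T) := fun t ht => by
    simp only [σHat, θHat]
    rw [cos_sub, Complex.cos_arg (hne t ht), Complex.sin_arg]
  have hcont : ContinuousOn (fun t => cos (E.σHat X i t)) (Ico 0 T) := by
    refine ContinuousOn.congr ?_ heq
    have hn : ∀ t ∈ Ico 0 T, ‖z t‖ ≠ 0 := fun t ht => norm_ne_zero_iff.2 (hne t ht)
    exact ((continuous_cos.comp_continuousOn (h.γ_cont i)).mul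
      ((Complex.continuous_re.comp_continuousOn hzc).div hzc.norm hn)).add
      ((continuous_sin.comp_continuousOn (h.γ_cont i)).mul
      ((Complex.continuous_im.comp_continuousOn hzc).div hzc.norm hn))
  by_contra hneg
  have hsub : Icc 0 t ⊆ Ico 0 T := fun u hu => ⟨hu.1, hu.2.trans_lt ht.2⟩
  obtain ⟨u, hu, hu0⟩ := intermediate_value_Icc' ht.1 (hcont.mono hsub) ⟨not_lt.1 hneg, h0.le⟩
  refine h.sin_ne i u (hsub hu) ?_
  simp only at hu0
  rw [sin_two_mul, hu0, mul_zero]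

theorem lead_rate_eq {V k r s c : ℝ} (hr : r ≠ 0) (hs : s ≠ 0) (hc : 0 < c)
    (hsc : s ^ 2 + c ^ 2 = 1) :
    V * k * (c - 1) / (r * (2 * s * c)) + V * s / (2 * r) =
      V / (2 * r) * (s * (1 - k * ((1 + c) * c)⁻¹)) := by
  have h1 : 1 + c ≠ 0 := by positivity
  field_simp
  linear_combination V * k * hsc

theorem consensusTerm_eq_zero {t : ℝ} (h : ∀ i, E.err X tgod i t = 0) (i : Fin N) :
    E.consensusTerm X tgod i t = 0 := by
  simp [consensusTerm, h]

/-- Simultaneous interception: a regular trajectory whose time-to-go errors vanish from `te` on and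
whose lead angles are acute extends until all ranges vanish. -/
theorem IsClosedLoop.exists_interception {Tf : ℝ} (h : E.IsClosedLoop X (fun t => Tf - t) T)
    (hV : ∀ i, 0 < E.V i) (hnav : ∀ i, 2 < E.nav i) (htp : 0 < E.tp) (hte : E.tp < E.te)
    (hT : E.te < T) (hTf : T ≤ Tf) (hest : ∀ i, ∀ t ∈ Ico E.tp T, X.est i t = E.target)
    (herr : ∀ i, ∀ t ∈ Ico E.te T, E.err X (fun t => Tf - t) i t = 0)
    (hacute : ∀ i, 0 < cos (E.σHat X i 0)) :
    ∃ Y : History N,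
      (∀ i, ∀ t ∈ Ico 0 T, Y.r i t = X.r i t ∧ Y.θ i t = X.θ i t ∧ Y.γ i t = X.γ i t ∧
        Y.est i t = X.est i t) ∧
      E.IsClosedLoop Y (fun t => Tf - t) Tf ∧
      (∀ i, ∀ t ∈ Ico E.te Tf, E.err Y (fun t => Tf - t) i t = 0) ∧
      (∀ i, ∀ t ∈ Ico 0 Tf, 0 < Y.r i t) ∧
      (∀ i, Tendsto (Y.r i) (𝓝[<] Tf) (𝓝 0)) := by
  obtain ⟨t₁, ht₁, ht₁'⟩ := exists_between hT
  have hmem : ∀ t ∈ Ico t₁ T, t ∈ Ioo 0 T \ {E.tp, E.te} := fun t ht =>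
    ⟨⟨by linarith [ht.1], ht.2⟩, by
      simp only [mem_insert_iff, mem_singleton_iff, not_or]
      exact ⟨by linarith [ht.1], by linarith [ht.1]⟩⟩
  have hmem0 : ∀ t ∈ Ico t₁ T, t ∈ Ico 0 T := fun t ht => Ioo_subset_Ico_self (hmem t ht).1
  have hest' : ∀ t ∈ Ico t₁ T, ∀ i, X.est i t = E.target := fun t ht i =>
    hest i t ⟨by linarith [ht.1], ht.2⟩
  have herr' : ∀ t ∈ Ico t₁ T, ∀ i, E.err X (fun t => Tf - t) i t = 0 := fun t ht i =>
    herr i t ⟨by linarith [ht.1], ht.2⟩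
  have hcourse : ∀ i, IsTerminalCourse (E.V i) (E.k i) Tf t₁ T (leadAngle X i) (X.θ i) (X.r i) :=
    fun i =>
    have hcos : ∀ t ∈ Ico t₁ T, 0 < cos (leadAngle X i t) := fun t ht => by
      rw [← cos_σHat (E := E) (hest' t ht i) (h.r_pos i t (hmem0 t ht))]
      exact h.cos_σHat_pos (hacute i) (hmem0 t ht)
    { r_pos := fun t ht => h.r_pos i t (hmem0 t ht)
      timeToGo := fun t ht => sub_eq_zero.1 (herr' t ht i)
      cos_pos := hcos
      sin_ne := fun t ht => (h.sin_cos_ne (hmem0 t ht) (hest' t ht i)).1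
      r_deriv := fun t ht => h.r_deriv i t (hmem t ht)
      θ_deriv := fun t ht => h.θ_deriv i t (hmem t ht)
      σ_deriv := fun t ht => by
        refine (h.hasDerivAt_leadAngle hV (hmem t ht) (hest' t ht i)).congr_deriv ?_
        rw [consensusTerm_eq_zero (herr' t ht), add_zero]
        exact lead_rate_eq (h.r_pos i t (hmem0 t ht)).ne'
          (h.sin_cos_ne (hmem0 t ht) (hest' t ht i)).1 (hcos t ht) (sin_sq_add_cos_sq _) }
  have ht₁mem : t₁ ∈ Ico t₁ T := ⟨le_rfl, ht₁'⟩
  choose σ θ r hσ₁ hθ₁ hc using fun i => exists_isTerminalCourse (Tf := Tf) (t₁ := t₁) (hV i)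
    (k_pos hnav i) ((hcourse i).cos_pos t₁ ht₁mem) ((hcourse i).sin_ne t₁ ht₁mem) (X.θ i t₁)
  set Z : History N := ⟨r, θ, fun i t => θ i t + σ i t, fun _ _ => E.target⟩ with hZ
  have hZlead : ∀ i t, leadAngle Z i t = σ i t := fun i t => by simp [leadAngle, hZ]
  have hXZ : ∀ t ∈ Ico t₁ T, AgreeAt X Z t := by
    intro t ht i
    obtain ⟨h1, h2, h3⟩ := ((hc i).mono hTf).eq (hcourse i) (hV i) (k_pos hnav i) hTf (hσ₁ i) (hθ₁ i) ht
    refine ⟨h3, h2, ?_, (hest' t ht i).symm⟩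
    simp only [hZ, h1, h2, leadAngle]
    ring
  have hZerr : ∀ t ∈ Ico t₁ Tf, ∀ i, E.err Z (fun t => Tf - t) i t = 0 := fun t ht i => by
    rw [err, timeToGo, hZlead]
    exact sub_eq_zero.2 ((hc i).timeToGo t ht)
  have hZreg : ∀ t ∈ Ico t₁ Tf, E.IsRegularAt Z (fun t => Tf - t) t := by
    intro t ht
    have hr : ∀ i, 0 < Z.r i t := fun i => (hc i).r_pos t ht
    have hZσ : ∀ i, Z.γ i t - Z.θ i t = σ i t := fun i => hZlead i t
    exact
      { r_pos := hr
        rHat_ne := fun i => by rw [rHat_eq rfl (hr i)]; exact (hr i).ne'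
        sin_ne := fun i => by
          rw [sin_two_mul, cos_σHat rfl (hr i), sin_σHat rfl (hr i), hZlead]
          exact mul_ne_zero (mul_ne_zero two_ne_zero ((hc i).sin_ne t ht))
            ((hc i).cos_pos t ht).ne'
        r_deriv := fun i => by rw [hZσ]; exact (hc i).r_deriv t ht
        θ_deriv := fun i => by rw [hZσ]; exact (hc i).θ_deriv t ht
        γ_deriv := fun i => by
          rw [command_eq rfl (hr i) (hV i), hZlead, consensusTerm_eq_zero (hZerr t ht), add_zero,
            lead_rate_eq (hr i).ne' ((hc i).sin_ne t ht) ((hc i).cos_pos t ht)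
              (sin_sq_add_cos_sq _)]
          exact ((hc i).θ_deriv t ht).add ((hc i).σ_deriv t ht)
        est_deriv := fun i => by
          rw [relErr_eq_zero fun _ => rfl, mul_zero, neg_zero]
          exact hasDerivAt_const t E.target }
  set Y : History N := ⟨fun i t => if t < T then X.r i t else r i t,
    fun i t => if t < T then X.θ i t else θ i t,
    fun i t => if t < T then X.γ i t else θ i t + σ i t,
    fun i t => if t < T then X.est i t else E.target⟩ with hY
  have hYX : ∀ t < T, AgreeAt X Y t := fun t ht i => by simp [hY, ht]
  have hYZ : ∀ t, t₁ ≤ t → AgreeAt Z Y t := by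
    intro t ht i
    rcases lt_or_ge t T with htT | htT
    · have h1 := hYX t htT i
      have h2 := hXZ t ⟨ht, htT⟩ i
      exact ⟨h1.1.trans h2.1.symm, h1.2.1.trans h2.2.1.symm, h1.2.2.1.trans h2.2.2.1.symm,
        h1.2.2.2.trans h2.2.2.2.symm⟩
    · simp [hY, hZ, htT.not_gt]
  have hYloop : E.IsClosedLoop Y (fun t => Tf - t) Tf := h.extend hYX fun t ht =>
    (hZreg t ⟨ht₁'.le.trans ht.1, ht.2⟩).congr
      (by filter_upwards [Ioi_mem_nhds (ht₁'.trans_le ht.1)] with u hu using hYZ u (le_of_lt hu))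
  have hYerr : ∀ i, ∀ t ∈ Ico E.te Tf, E.err Y (fun t => Tf - t) i t = 0 := by
    intro i t ht
    rcases lt_or_ge t T with htT | htT
    · rw [(hYX t htT).err]
      exact herr i t ⟨ht.1, htT⟩
    · rw [(hYZ t (ht₁'.le.trans htT)).err]
      exact hZerr t ⟨ht₁'.le.trans htT, ht.2⟩ i
  refine ⟨Y, fun i t ht => hYX t ht.2 i, hYloop, hYerr, hYloop.r_pos, fun i => ?_⟩
  have hlim : Tendsto (fun t => E.V i * (Tf - t)) (𝓝[<] Tf) (𝓝 0) := by
    have : Tendsto (fun t => E.V i * (Tf - t)) (𝓝 Tf) (𝓝 (E.V i * (Tf - Tf))) :=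
      Continuous.tendsto (by fun_prop) _
    rw [sub_self, mul_zero] at this
    exact this.mono_left nhdsWithin_le_nhds
  have hev : ∀ᶠ t in 𝓝[<] Tf, t ∈ Ico E.te Tf := by
    filter_upwards [Ioo_mem_nhdsLT (hT.trans_le hTf)] with t ht using Ioo_subset_Ico_self ht
  refine squeeze_zero' (hev.mono fun t ht => ?_) (hev.mono fun t ht => ?_) hlim
  · exact (hYloop.r_pos i t ⟨by linarith [ht.1], ht.2⟩).le
  · have h1 : E.timeToGo Y i t = Tf - t := sub_eq_zero.1 (hYerr i t ht)
    have hr := hYloop.r_pos i t ⟨by linarith [ht.1], ht.2⟩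
    have hk : 0 < E.k i := by linarith [k_pos hnav i]
    have h2 : Y.r i t / E.V i ≤ Tf - t := by
      rw [← h1, timeToGo]
      have := hV i
      exact le_mul_of_one_le_right (by positivity) (by
        have : 0 ≤ sin (leadAngle Y i t) ^ 2 / E.k i := by positivity
        linarith)
    rw [div_le_iff₀ (hV i)] at h2
    linarith

end Engagement

theorem mainTheorem2 {N : ℕ} (hN : 2 ≤ N) (E : Engagement N)
    (hV : ∀ i, 0 < E.V i) (hnav : ∀ i, 2 < E.nav i)
    -- the target receives no information and is the root of a spanning tree of the sensing graph
    (hleader : ∀ i, ¬ E.S.Adj i 0) (hroot : ∀ i, Relation.ReflTransGen E.S.Adj 0 i)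
    (hA : StronglyConnected E.A)
    (hα : 0 < E.α) (hβ : 2 * eigMax (observerM E.S) / eigMin (observerC E.S) ≤ E.β)
    (hζ : 0 < E.ζ) (hη : 1 / mirrorLambda2 hN E.A ≤ E.η)
    (htp : 0 < E.tp) (hte : E.tp < E.te) (R : ℝ) :
    -- boundedness of the errors before the observer has converged, for every regular trajectory
    (∃ C : ℝ, ∀ (X : History N) (tgod : ℝ → ℝ) (T : ℝ),
      E.IsClosedLoop X tgod T → (∀ i, X.r i 0 ≤ R) →
      ∀ i j, ∀ t ∈ Ico 0 T, t < E.tp → |E.err X tgod i t - E.err X tgod j t| ≤ C) ∧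
    -- consensus and interception, for every trajectory that is regular up to the time `te`
    (∃ C : ℝ, ∀ (X : History N) (tgod : ℝ → ℝ) (T : ℝ), E.te ≤ T →
      E.IsClosedLoop X tgod T → (∀ i, X.r i 0 ≤ R) →
      ∃ Tf : ℝ, T ≤ Tf ∧
        -- the time-to-go errors are formed with `t ↦ Tf - t`
        E.IsClosedLoop X (fun t => Tf - t) T ∧
        -- they stay bounded, uniformly in the trajectory
        (∀ i, ∀ t ∈ Ico 0 T, |E.err X (fun t => Tf - t) i t| ≤ C) ∧
        -- they reach zero at the predefined time and remain zero
        (∀ i, Tendsto (E.err X (fun t => Tf - t) i) (𝓝[<] E.te) (𝓝 0)) ∧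
        (∀ i, ∀ t ∈ Ico E.te T, E.err X (fun t => Tf - t) i t = 0) ∧
        -- simultaneous interception at the time `Tf`
        (E.te < T → (∀ i, 0 < cos (E.σHat X i 0)) →
          ∃ Y : History N,
            (∀ i, ∀ t ∈ Ico 0 T, Y.r i t = X.r i t ∧ Y.θ i t = X.θ i t ∧ Y.γ i t = X.γ i t ∧
              Y.est i t = X.est i t) ∧
            E.IsClosedLoop Y (fun t => Tf - t) Tf ∧
            (∀ i, ∀ t ∈ Ico E.te Tf, E.err Y (fun t => Tf - t) i t = 0) ∧
            (∀ i, ∀ t ∈ Ico 0 Tf, 0 < Y.r i t) ∧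
            (∀ i, Tendsto (Y.r i) (𝓝[<] Tf) (𝓝 0)))) := by
  have hN0 : 0 < N := by omega
  have hβ0 := observer_gain_pos hN0 hroot hβ
  have hη0 : 0 < E.η := (one_div_pos.2 (mirrorLambda2_pos hN hA)).trans_le hη
  have hte0 : 0 < E.te := htp.trans hte
  refine ⟨⟨E.timeToGoBound R, fun X tgod T h hR i j t ht htt => ?_⟩,
    ⟨E.timeToGoBound R + E.te, fun X tgod T hT h hR => ?_⟩⟩
  · have hle := fun i => h.timeToGo_le hV hnav hte0 hR i ht (htt.trans hte).le
    have hpos := fun i => h.timeToGo_pos hV hnav i ht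
    simp only [Engagement.err, sub_sub_sub_cancel_right]
    rw [abs_le]
    constructor <;> linarith [hle i, hle j, hpos i, hpos j]
  · have hest : ∀ i, ∀ t ∈ Ico E.tp T, X.est i t = E.target := fun i t ht =>
      h.est_eq hroot hα hβ0 htp (hte.le.trans hT) i ht
    obtain ⟨Tf, hTf, hbound, hlim, hzero⟩ := h.exists_final_time hN0 hV hnav hA hζ hη0 htp hte hT
      hest fun i t ht htt => h.timeToGo_le hV hnav hte0 hR i ht htt
    have h' := h.change_desired fun t => Tf - t
    exact ⟨Tf, hTf, h', hbound, hlim, hzero, fun hT' hacute =>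
      h'.exists_interception hV hnav htp hte hT' hTf hest hzero hacute⟩
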